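/- **Conventions.** "Computable" means computable by Kleene's schemes S1–S9 on arguments of finite (pure) type, and $\exists^2:\mathbb N^{\mathbb N}\to\{0,1\}$ is Kleene's quantifier: $\exists^2(\alpha)=0$ iff $\alpha(n)=0$ for some $n$. A name of a real $x$ is a sequence of (codes of) rationals $(q_n)_{n\in\mathbb N}$ with $|q_n-x|\le 2^{-n}$ for all $n$. A function $f:[0,1]\to\mathbb R$ is given by any type 2 functional $\Phi$ such that, for every name $\alpha$ of every $x\in[0,1]$, the sequence $n\mapsto\Phi(n,\alpha)$ is a name of $f(x)$. "$\exists^2$ computes" an object from $f$ means that a single S1–S9 index, independent of $f$, computes it from $\exists^2$ and any $\Phi$ representing $f$; real inputs are given by arbitrary names, rational inputs by codes, real outputs are produced as names; and the object computed depends on $f$ and on the real and rational inputs only, not on the chosen representations. Extended reals in $(-\infty,+\infty]$ are produced as a bit telling whether the value is finite, followed in the finite case by a name of it. A function $f:[0,1]\to\mathbb R$ is quasi-continuous if for every $x_0\in[0,1]$, every $\varepsilon>0$ and every (relatively) open $U\subset[0,1]$ containing $x_0$ there is a non-empty (relatively) open $G\subset U$ with $|f(x_0)-f(x)|<\varepsilon$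 for all $x\in G$. $C_f$ is the set of points of $[0,1]$ at which $f$ is continuous, and $B(x,r)$ is the open ball. **Theorem.** For quasi-continuous $f:[0,1]\to\mathbb R$ we have the following. (a) $\exists^2$ computes the characteristic function of $C_f$ on $[0,1]$, and $\exists^2$ computes some $x\in C_f$. (b) $\exists^2$ computes a double sequence of rational open balls $B(c_{n,i},r_{n,i})$, with $c_{n,i}\in\mathbb Q$ and $r_{n,i}\in\mathbb Q$, $r_{n,i}>0$, such that $C_f=\bigcap_{n}O_n$, where $O_n=[0,1]\cap\bigcup_i B(c_{n,i},r_{n,i})$. (c) $\exists^2$ computes the oscillation function $\mathrm{osc}_f:[0,1]\to[0,+\infty]$, $\mathrm{osc}_f(x)=\lim_{k\to\infty}\bigl(\sup_{B(x,2^{-k})\cap[0,1]}f-\inf_{B(x,2^{-k})\cap[0,1]}f\bigr)$. (d) $\exists^2$ computes $\sup_{x\in[p,q]}f(x)\in(-\infty,+\infty]$ from rationals $0\le p\le q\le1$. (e) $\exists^2$ computes a modulus of continuity, i.e. a function $F:[0,1]\times\mathbb N\to\mathbb N$ such that for all $k\in\mathbb N$, $x\in C_f$, $y\in[0,1]$: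 if $|x-y|<2^{-F(x,k)}$, then $|f(x)-f(y)|<2^{-k}$. (f) $\exists^2$ computes a modulus of quasi-continuity, i.e. a function assigning to each $x\in[0,1]$ and $k,N\in\mathbb N$ rationals $c<d$ with $(c,d)\subset[0,1]\cap B(x,2^{-N})$ and $|f(x)-f(y)|<2^{-k}$ for all $y\in(c,d)$. (g) For quasi-continuous $\Psi:[0,1]\to(0,\infty)$, $\exists^2$ computes from $\Psi$ some $m\in\mathbb N$ and $x_0,\dots,x_m\in[0,1]$ such that $[0,1]\subset\bigcup_{i\le m}B(x_i,\Psi(x_i))$. (h) If moreover $f$ takes values in $[0,1]$ and is Riemann integrable with $\int_0^1f(x)\,dx=0$, then $\exists^2$ computes some $x\in[0,1]$ with $f(x)=0$. (i) If moreover $f$ is Riemann integrable and $F(x)=\int_0^xf(t)\,dt$, then $\exists^2$ computes some $x_0\in(0,1)$ such that $F$ is differentiable at $x_0$ and $F'(x_0)=f(x_0)$. -/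

import Mathlib

open Set Filter Topology

/-! ## Kleene's S1-S9 computability -/

/-- The pure finite types: type `0` is `ℕ`, type `j + 1` consists of all total maps from
type `j` to `ℕ`.  So type `1` is Baire space and type `2` is `(ℕ → ℕ) → ℕ`. -/
def PureType : ℕ → Type
  | 0 => ℕ
  | j + 1 => PureType j → ℕ

/-- An argument of a computation: an object of some pure type. -/
abbrev Arg : Type := Σ j : ℕ, PureType j

/-- A natural number as an argument. -/
def num (n : ℕ) : Arg := ⟨0, n⟩

/-- An element of Baire space as an argument. -/
def fn (α : ℕ → ℕ) : Arg := ⟨1, α⟩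

/-- A type 2 functional as an argument. -/
def fnl (Y : (ℕ → ℕ) → ℕ) : Arg := ⟨2, Y⟩

/-- `Kleene e a y` says that the computation with index `e` on the finite list of arguments `a`
terminates with value `y`, in symbols `{e}(a) = y`.  The constructors are Kleene's schemes S1-S9;
an index is a natural number coding the number of the scheme together with its data. -/
inductive Kleene : ℕ → List Arg → ℕ → Prop
  /-- S1, successor: `{e}(x, b) = x + 1`. -/
  | s1 (x : ℕ) (b : List Arg) :
      Kleene (Nat.pair 1 0) (num x :: b) (x + 1)
  /-- S2, constants: `{e}(b) = q`. -/
  | s2 (q : ℕ) (b : List Arg) :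
      Kleene (Nat.pair 2 q) b q
  /-- S3, projection: `{e}(x, b) = x`. -/
  | s3 (x : ℕ) (b : List Arg) :
      Kleene (Nat.pair 3 0) (num x :: b) x
  /-- S4, composition: `{e}(b) = {g}({h}(b), b)`. -/
  | s4 {g h : ℕ} {b : List Arg} {x y : ℕ} :
      Kleene h b x → Kleene g (num x :: b) y →
      Kleene (Nat.pair 4 (Nat.pair g h)) b y
  /-- S5, primitive recursion: `{e}(0, b) = {g}(b)`. -/
  | s5_zero {g h : ℕ} {b : List Arg} {y : ℕ} :
      Kleene g b y →
      Kleene (Nat.pair 5 (Nat.pair g h)) (num 0 :: b) y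
  /-- S5, primitive recursion: `{e}(x + 1, b) = {h}(x, {e}(x, b), b)`. -/
  | s5_succ {g h x : ℕ} {b : List Arg} {z y : ℕ} :
      Kleene (Nat.pair 5 (Nat.pair g h)) (num x :: b) z →
      Kleene h (num x :: num z :: b) y →
      Kleene (Nat.pair 5 (Nat.pair g h)) (num (x + 1) :: b) y
  /-- S6, permutation of arguments: the argument at position `k` is moved to the front. -/
  | s6 {k g : ℕ} {b c : List Arg} {x : Arg} {y : ℕ} :
      b.length = k → Kleene g (x :: (b ++ c)) y →
      Kleene (Nat.pair 6 (Nat.pair k g)) (b ++ x :: c) y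
  /-- S7, application of a type 1 argument: `{e}(α, x, b) = α(x)`. -/
  | s7 (α : ℕ → ℕ) (x : ℕ) (b : List Arg) :
      Kleene (Nat.pair 7 0) (fn α :: num x :: b) (α x)
  /-- S8, application of an argument of type `j + 2`: `{e}(F, b) = F(λ τ. {g}(F, τ, b))`, where
  `τ` ranges over all objects of type `j` and `λ τ. {g}(F, τ, b)` has to be total. -/
  | s8 {g j : ℕ} {F : PureType (j + 2)} {G : PureType (j + 1)} {b : List Arg} :
      (∀ τ : PureType j, Kleene g (⟨j + 2, F⟩ :: ⟨j, τ⟩ :: b) (G τ)) →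
      Kleene (Nat.pair 8 g) (⟨j + 2, F⟩ :: b) (F G)
  /-- S9, reflection: `{e}(d, b, c) = {d}(b)`. -/
  | s9 {k d : ℕ} {b c : List Arg} {y : ℕ} :
      b.length = k → Kleene d b y →
      Kleene (Nat.pair 9 k) (num d :: (b ++ c)) y

open Classical in
/-- Kleene's quantifier `∃²`. -/
noncomputable def existsTwo (α : ℕ → ℕ) : ℕ := if ∃ n, α n = 0 then 0 else 1

/-! ## Coding of rationals, reals and functions on the unit interval -/

/-- Every natural number codes a rational, and every rational has a code. -/
def ratOf (c : ℕ) : ℚ :=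
  ((c.unpair.1.unpair.1 : ℚ) - (c.unpair.1.unpair.2 : ℚ)) / ((c.unpair.2 : ℚ) + 1)

/-- Every natural number codes a pair of rationals. -/
def ratPairOf (c : ℕ) : ℚ × ℚ := (ratOf c.unpair.1, ratOf c.unpair.2)

/-- `α` is a name of the real `x`: a sequence of (codes of) rationals that converges to `x`
with the rate `2⁻ⁿ`. -/
def Names (α : ℕ → ℕ) (x : ℝ) : Prop := ∀ n : ℕ, |(ratOf (α n) : ℝ) - x| ≤ 1 / 2 ^ n

/-- `α` is a name of the extended real `v > -∞`: the entry `α 0` tells whether `v` is finite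
(`0`) or `+∞` (`1`), and in the first case the remaining entries form a name of `v`. -/
def NamesExt (α : ℕ → ℕ) (v : EReal) : Prop :=
  (α 0 = 0 ∧ ∃ r : ℝ, v = (r : EReal) ∧ Names (fun n => α (n + 1)) r) ∨ (α 0 = 1 ∧ v = ⊤)

/-- The sequence `n, α 0, α 1, …`. -/
def consSeq (n : ℕ) (α : ℕ → ℕ) : ℕ → ℕ
  | 0 => n
  | i + 1 => α i

/-- The type 2 functional `Φ` represents `f : [0,1] → ℝ`: the map `α ↦ (n ↦ Φ (n, α))` sends
every name of every `x ∈ [0,1]` to a name of `f x`. -/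
def Represents (Φ : (ℕ → ℕ) → ℕ) (f : Icc (0 : ℝ) 1 → ℝ) : Prop :=
  ∀ (x : Icc (0 : ℝ) 1) (α : ℕ → ℕ), Names α x → Names (fun n => Φ (consSeq n α)) (f x)

/-- The index `e` computes the real `x` from the arguments `a`. -/
def ComputesReal (e : ℕ) (a : List Arg) (x : ℝ) : Prop :=
  ∃ β : ℕ → ℕ, Names β x ∧ ∀ n, Kleene e (a ++ [num n]) (β n)

/-- The index `e` computes the extended real `v` from the arguments `a`. -/
def ComputesExt (e : ℕ) (a : List Arg) (v : EReal) : Prop :=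
  ∃ β : ℕ → ℕ, NamesExt β v ∧ ∀ n, Kleene e (a ++ [num n]) (β n)

/-- The index `e` computes the pair of rationals `p` from the arguments `a`. -/
def ComputesRatPair (e : ℕ) (a : List Arg) (p : ℚ × ℚ) : Prop :=
  ∃ c : ℕ, ratPairOf c = p ∧ Kleene e a c

/-! ## Notions from real analysis -/

/-- Quasi-continuity of `f : [0,1] → ℝ` (at every point); open sets are those of `[0,1]`. -/
def QuasiContinuous (f : Icc (0 : ℝ) 1 → ℝ) : Prop :=
  ∀ x₀ : Icc (0 : ℝ) 1, ∀ ε > 0, ∀ U : Set (Icc (0 : ℝ) 1), IsOpen U → x₀ ∈ U →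
    ∃ G : Set (Icc (0 : ℝ) 1), IsOpen G ∧ G.Nonempty ∧ G ⊆ U ∧ ∀ x ∈ G, |f x₀ - f x| < ε

/-- The set `C_f` of continuity points. -/
def contSet (f : Icc (0 : ℝ) 1 → ℝ) : Set (Icc (0 : ℝ) 1) := {x | ContinuousAt f x}

/-- The oscillation of `f` on a (non-empty) set `S`: supremum minus infimum. -/
noncomputable def oscOn (f : Icc (0 : ℝ) 1 → ℝ) (S : Set (Icc (0 : ℝ) 1)) : EReal :=
  (⨆ y ∈ S, (f y : EReal)) - ⨅ y ∈ S, (f y : EReal)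

/-- `v` is the oscillation of `f` at `x`: the limit of the oscillations on `B(x, 2⁻ᵏ)`. -/
def IsOscAt (f : Icc (0 : ℝ) 1 → ℝ) (x : Icc (0 : ℝ) 1) (v : EReal) : Prop :=
  Tendsto (fun k : ℕ => oscOn f (Metric.ball x (1 / 2 ^ k))) atTop (𝓝 v)

/-- `F` is a modulus of continuity of `f`. -/
def IsModulusCont (f : Icc (0 : ℝ) 1 → ℝ) (F : Icc (0 : ℝ) 1 → ℕ → ℕ) : Prop :=
  ∀ (k : ℕ), ∀ x ∈ contSet f, ∀ y : Icc (0 : ℝ) 1,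
    |(x : ℝ) - y| < 1 / 2 ^ F x k → |f x - f y| < 1 / 2 ^ k

/-- `F` is a modulus of quasi-continuity of `f`: the pair `F x k N` is a non-empty open rational
interval contained in `[0,1]` and in `B(x, 2⁻ᴺ)`, on which `f` differs from `f x` by less
than `2⁻ᵏ`. -/
def IsModulusQuasiCont (f : Icc (0 : ℝ) 1 → ℝ) (F : Icc (0 : ℝ) 1 → ℕ → ℕ → ℚ × ℚ) : Prop :=
  ∀ (x : Icc (0 : ℝ) 1) (k N : ℕ),
    (F x k N).1 < (F x k N).2 ∧
    Ioo ((F x k N).1 : ℝ) ((F x k N).2 : ℝ) ⊆ Icc (0 : ℝ) 1 ∩ Metric.ball (x : ℝ) (1 / 2 ^ N) ∧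
    ∀ y : Icc (0 : ℝ) 1, (y : ℝ) ∈ Ioo ((F x k N).1 : ℝ) ((F x k N).2 : ℝ) →
      |f x - f y| < 1 / 2 ^ k

/-- `f` is Riemann integrable on `[a,b]` with integral `J`: the Riemann sums over tagged
partitions `a = t 0 ≤ ξ 0 ≤ t 1 ≤ ξ 1 ≤ … ≤ t n = b` tend to `J` as the mesh tends to `0`. -/
def HasRiemannIntegral (f : Icc (0 : ℝ) 1 → ℝ) (a b : Icc (0 : ℝ) 1) (J : ℝ) : Prop :=
  ∀ ε > 0, ∃ δ > 0, ∀ (n : ℕ) (t ξ : ℕ → Icc (0 : ℝ) 1), t 0 = a → t n = b →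
    (∀ i < n, t i ≤ ξ i ∧ ξ i ≤ t (i + 1) ∧ (t (i + 1) : ℝ) - t i < δ) →
    |(∑ i ∈ Finset.range n, f (ξ i) * ((t (i + 1) : ℝ) - t i)) - J| < ε

/-!
For a quasi-continuous `f` the values at the rational points of `[0,1]` control all others: every
value `f y` with `y` in an open set `U` is a limit of values at rational points of `U`
(`QuasiContinuous.mem_of_unitPoint`).  Hence suprema, oscillations and statements such as "`f`
oscillates by at most `2⁻ⁿ` on `U`" are expressed by quantifiers over natural numbers applied to
values of `f` at rational points, and `∃²` decides all of these.

On the side of computability, `Setting.Comp` collects the number-valued maps that have a single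
Kleene index relative to `∃²`, a representation of `f` and possibly a name of a point.  It contains
the primitive recursive functions and is closed under composition, primitive recursion, numerical
quantification (`Setting.Dec.ex`, from S8 applied to `∃²`) and unbounded search
(`Setting.Comp.least`, from S9).  A real number is treated through its lower Dedekind cut
(`Setting.Cut`).  The cut depends on the real alone; as least witnesses of decided predicates are
used throughout, every object computed depends on `f` and on the real and rational inputs, but not
on the chosen representation or names.

The mathematical content is then as follows.  Continuity at `x` means that `f` has small
oscillation on balls around `x`, which gives the decision of `C_f`, its presentation as an
intersection of unions of rational balls, and the moduli by search.  A continuity point is the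
common point of a nested sequence of rational intervals of decreasing oscillation
(`contPoint`); quasi-continuity provides each next interval.  For a positive quasi-continuous `Ψ`
already the balls `B(r, Ψ r)` with rational `r` cover `[0,1]`, so that a search for a finite
subcovering with a margin `2⁻ᴺ`, which can be tested at rational points, is successful.  Finally,
Riemann sums show that a nonnegative function with integral `0` vanishes at its continuity points,
and that the derivative of the integral is `f x` at every continuity point `x` in `(0,1)`; in both
cases `contPoint` is a point as required.
-/

open Encodable (encode)

/-! ### Combinators for Kleene indices -/

/-- `UComp A g`: one index computes `g s` from the argument list `A s`, for all `s` at once. -/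
def UComp {σ : Type} (A : σ → List Arg) (g : σ → ℕ) : Prop :=
  ∃ e, ∀ s, Kleene e (A s) (g s)

namespace UComp

variable {σ τ : Type} {A : σ → List Arg} {g : σ → ℕ}

theorem reindex (h : UComp A g) (r : τ → σ) : UComp (fun t => A (r t)) (fun t => g (r t)) :=
  h.imp fun _ he t => he (r t)

theorem const (A : σ → List Arg) (q : ℕ) : UComp A (fun _ => q) :=
  ⟨_, fun _ => .s2 q _⟩

theorem head (A : σ → List Arg) (x : σ → ℕ) : UComp (fun s => num (x s) :: A s) x :=
  ⟨_, fun _ => .s3 _ _⟩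

/-- An auxiliary number may be computed and put in front of the arguments (S4). -/
theorem push {x : σ → ℕ} (hx : UComp A x) (h : UComp (fun s => num (x s) :: A s) g) :
    UComp A g := by
  obtain ⟨e, he⟩ := hx
  obtain ⟨d, hd⟩ := h
  exact ⟨_, fun s => .s4 (he s) (hd s)⟩

/-- The only permutations that S6 offers are those that move one argument to the front. -/
theorem moveFront {k : ℕ} {x : σ → Arg} {b c : σ → List Arg} (hb : ∀ s, (b s).length = k)
    (h : UComp (fun s => x s :: (b s ++ c s)) g) : UComp (fun s => b s ++ x s :: c s) g := by
  obtain ⟨e, he⟩ := h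
  exact ⟨_, fun s => .s6 (hb s) (he s)⟩

theorem swap {x y : σ → Arg} (h : UComp (fun s => y s :: x s :: A s) g) :
    UComp (fun s => x s :: y s :: A s) g :=
  moveFront (b := fun s => [x s]) (k := 1) (fun _ => rfl) h

theorem rotate₃ {x y z : σ → Arg} (h : UComp (fun s => z s :: x s :: y s :: A s) g) :
    UComp (fun s => x s :: y s :: z s :: A s) g :=
  moveFront (b := fun s => [x s, y s]) (k := 2) (fun _ => rfl) h

theorem rotate₄ {x y z w : σ → Arg} (h : UComp (fun s => w s :: x s :: y s :: z s :: A s) g) :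
    UComp (fun s => x s :: y s :: z s :: w s :: A s) g :=
  moveFront (b := fun s => [x s, y s, z s]) (k := 3) (fun _ => rfl) h

/-- A leading number may be ignored.  No scheme discards an argument, but a primitive recursion
whose step returns the previous value does so. -/
theorem drop (x : σ → ℕ) (h : UComp A g) : UComp (fun s => num (x s) :: A s) g := by
  obtain ⟨e, he⟩ := h
  refine ⟨Nat.pair 5 (Nat.pair e (Nat.pair 6 (Nat.pair 1 (Nat.pair 3 0)))), fun s => ?_⟩
  show Kleene _ (num (x s) :: A s) _
  induction x s with
  | zero => exact .s5_zero (he s)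
  | succ n ih => exact .s5_succ ih (Kleene.s6 (b := [num n]) (c := A s) rfl (Kleene.s3 _ _))

theorem dropSecond {x : σ → Arg} (y : σ → ℕ) (h : UComp (fun s => x s :: A s) g) :
    UComp (fun s => x s :: num (y s) :: A s) g :=
  swap (drop y h)

theorem dropThird {x y : σ → Arg} (z : σ → ℕ) (h : UComp (fun s => x s :: y s :: A s) g) :
    UComp (fun s => x s :: y s :: num (z s) :: A s) g :=
  rotate₃ (drop z h)

theorem dropList {m : ℕ} (x : Fin m → σ → ℕ) (h : UComp A g) :
    UComp (fun s => (List.ofFn fun i => num (x i s)) ++ A s) g := by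
  induction m with
  | zero => simpa using h
  | succ m ih =>
    simp only [List.ofFn_succ, List.cons_append]
    exact drop _ (ih fun i => x i.succ)

theorem pushList {m : ℕ} {x : Fin m → σ → ℕ} (hx : ∀ i, UComp A (x i))
    (h : UComp (fun s => (List.ofFn fun i => num (x i s)) ++ A s) g) : UComp A g := by
  induction m with
  | zero => simpa using h
  | succ m ih =>
    simp only [List.ofFn_succ, List.cons_append] at h
    exact ih (x := fun i => x i.succ) (fun i => hx i.succ) (push (dropList _ (hx 0)) h)

theorem app₁ (α : σ → ℕ → ℕ) (x : σ → ℕ) (A : σ → List Arg) :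
    UComp (fun s => fn (α s) :: num (x s) :: A s) (fun s => α s (x s)) :=
  ⟨_, fun _ => .s7 _ _ _⟩

/-- S8 for type 2 arguments, where the inner computation has to be total. -/
theorem app₂ {Y : σ → (ℕ → ℕ) → ℕ} {G : σ → ℕ → ℕ}
    (h : UComp (σ := σ × ℕ) (fun s => fnl (Y s.1) :: num s.2 :: A s.1) (fun s => G s.1 s.2)) :
    UComp (fun s => fnl (Y s) :: A s) (fun s => Y s (G s)) := by
  obtain ⟨e, he⟩ := h
  exact ⟨Nat.pair 8 e, fun s =>
    Kleene.s8 (j := 0) (F := Y s) (G := G s) (b := A s) fun m => he (s, m)⟩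

/-- Primitive recursive functions are computed, uniformly in the arguments `s.2` that follow the
numerical ones. -/
theorem ofPrimrec' {n : ℕ} {f : List.Vector ℕ n → ℕ} (hf : Nat.Primrec' f) :
    UComp (σ := List.Vector ℕ n × List Arg) (fun s => s.1.toList.map num ++ s.2)
      (fun s => f s.1) := by
  induction hf with
  | zero => exact const _ 0
  | succ =>
    refine ⟨Nat.pair 1 0, fun ⟨v, b⟩ => ?_⟩
    obtain ⟨x, w, rfl⟩ := v.exists_eq_cons
    exact .s1 _ _
  | @get n i =>
    refine ⟨Nat.pair 6 (Nat.pair i (Nat.pair 3 0)), fun ⟨v, b⟩ => ?_⟩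
    have hi : (i : ℕ) < v.toList.length := by simp
    have h := List.take_append_drop (i : ℕ) v.toList
    rw [List.drop_eq_getElem_cons hi] at h
    have h' : v.toList.map num ++ b = (v.toList.take i).map num ++
        num (v.get i) :: ((v.toList.drop (i + 1)).map num ++ b) := by
      have h'' := congrArg (List.map num) h
      rw [← h'']
      simp only [List.map_append, List.map_cons, List.append_assoc, List.cons_append,
        List.Vector.get_eq_get_toList]
      rfl
    simp only [h']
    exact .s6 (by simp) (.s3 _ _)
  | @comp n m f g _ _ hf hg =>
    refine pushList hg ?_
    refine (hf.reindex fun s : List.Vector ℕ n × List Arg =>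
      (List.Vector.ofFn fun i => g i s.1, s.1.toList.map num ++ s.2)).imp fun e he s => ?_
    convert he s using 2
    simp [List.map_ofFn, Function.comp_def]
  | @prec n f g _ _ hf hg =>
    obtain ⟨d, hd⟩ := hf
    obtain ⟨e, he⟩ := hg
    refine ⟨Nat.pair 5 (Nat.pair d e), fun ⟨v, b⟩ => ?_⟩
    obtain ⟨x, w, rfl⟩ := v.exists_eq_cons
    simp only [List.Vector.head_cons, List.Vector.tail_cons, List.Vector.toList_cons,
      List.map_cons, List.cons_append]
    induction x with
    | zero => exact .s5_zero (hd (w, b))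
    | succ x ih => exact .s5_succ ih (he (x ::ᵥ _ ::ᵥ w, b))

theorem primrec₁ {f : ℕ → ℕ} (hf : Primrec f) (x : σ → ℕ) (A : σ → List Arg) :
    UComp (fun s => num (x s) :: A s) (fun s => f (x s)) :=
  (ofPrimrec' (Nat.Primrec'.prim_iff₁.2 hf)).reindex fun s : σ => (x s ::ᵥ .nil, A s)

theorem primrec₂ {f : ℕ → ℕ → ℕ} (hf : Primrec₂ f) (x y : σ → ℕ) (A : σ → List Arg) :
    UComp (fun s => num (x s) :: num (y s) :: A s) (fun s => f (x s) (y s)) :=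
  (ofPrimrec' (Nat.Primrec'.prim_iff₂.2 hf)).reindex fun s : σ => (x s ::ᵥ y s ::ᵥ .nil, A s)

/-- Unbounded search for the least zero of `g`; the length of the argument list has to be fixed,
because the search calls itself by S9. -/
theorem find {k : ℕ} (hk : ∀ s, (A s).length = k) {G : σ → ℕ → ℕ}
    (h : UComp (σ := σ × ℕ) (fun s => num s.2 :: A s.1) (fun s => G s.1 s.2))
    (hG : ∀ s, ∃ m, G s m = 0) : UComp A (fun s => Nat.find (hG s)) := by
  -- The loop works on the list `(d, m, A)`, where `d` is the index of the loop itself.  It selects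
  -- the index of what has to be done next and runs it by S9: `o` returns `m`, and `r` calls `d` on
  -- `(d, m + 1, A)`.  The selection must not run both branches, since `r` need not terminate
  -- beforehand.
  obtain ⟨o, ho⟩ : UComp (σ := ℕ × ℕ × List Arg) (fun s => num s.1 :: num s.2.1 :: s.2.2)
      (fun s => s.2.1) := drop _ (head _ _)
  obtain ⟨r, hr⟩ : ∃ r, ∀ (d m y : ℕ) (s : σ), Kleene d (num d :: num (m + 1) :: A s) y →
      Kleene r (num d :: num m :: A s) y := by
    have : UComp (σ := {t : (ℕ × ℕ × ℕ) × σ //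
          Kleene t.1.1 (num t.1.1 :: num (t.1.2.1 + 1) :: A t.2) t.1.2.2})
        (fun t => num t.1.1.1 :: num t.1.1.2.1 :: A t.1.2) (fun t => t.1.1.2.2) := by
      refine push (x := fun t => t.1.1.2.1 + 1)
        (drop _ (primrec₁ (f := fun m => m + 1) Primrec.succ _ _)) ?_
      refine dropThird _ (swap (push (x := fun t => t.1.1.1) (head _ _) ?_))
      refine ⟨Nat.pair 9 (k + 2), fun t => ?_⟩
      have := Kleene.s9 (k := k + 2) (c := []) (by simp [hk]) t.2
      simpa using this
    obtain ⟨r, hr⟩ := this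
    exact ⟨r, fun d m y s hd => hr ⟨((d, m, y), s), hd⟩⟩
  obtain ⟨l, hl⟩ : ∃ l, ∀ (d m y : ℕ) (s : σ),
      Kleene (if G s m = 0 then o else r) (num d :: num m :: A s) y →
      Kleene l (num d :: num m :: A s) y := by
    have : UComp (σ := {t : (ℕ × ℕ × ℕ) × σ //
          Kleene (if G t.2 t.1.2.1 = 0 then o else r)
            (num t.1.1 :: num t.1.2.1 :: A t.2) t.1.2.2})
        (fun t => num t.1.1.1 :: num t.1.1.2.1 :: A t.1.2) (fun t => t.1.1.2.2) := by
      refine push (x := fun t => if G t.1.2 t.1.1.2.1 = 0 then o else r) (drop _ ?_)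
        ⟨Nat.pair 9 (k + 2), fun t => ?_⟩
      · refine push (h.reindex fun t : {t : (ℕ × ℕ × ℕ) × σ // _} => (t.1.2, t.1.1.2.1)) ?_
        exact primrec₁ (f := fun n => if n = 0 then o else r)
          (Primrec.ite (Primrec.eq.comp Primrec.id (Primrec.const 0)) (Primrec.const o)
            (Primrec.const r)) _ _
      · have := Kleene.s9 (k := k + 2) (c := []) (by simp [hk]) t.2
        simpa using this
    obtain ⟨l, hl⟩ := this
    exact ⟨l, fun d m y s hd => hl ⟨((d, m, y), s), hd⟩⟩
  have key : ∀ (s : σ) (i m : ℕ), m + i = Nat.find (hG s) →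
      Kleene l (num l :: num m :: A s) (Nat.find (hG s)) := by
    intro s i
    induction i with
    | zero =>
      intro m hm
      apply hl
      rw [← hm, if_pos (by rw [← add_zero m, hm]; exact Nat.find_spec (hG s))]
      exact ho (l, m, A s)
    | succ i ih =>
      intro m hm
      apply hl
      rw [if_neg (Nat.find_min (hG s) (by omega))]
      exact hr _ _ _ _ (ih (m + 1) (by omega))
  exact push (const _ 0) (push (const _ l) ⟨l, fun s => key s _ 0 (zero_add _)⟩)

end UComp

/-! ### Computability relative to `∃²` and a type 2 functional -/

/-- A family of argument lists `∃², Φ c, rest c` of constant length, indexed by `c : ι`. -/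
structure Setting (ι : Type) where
  /-- The type 2 argument that follows `∃²`. -/
  Φ : ι → (ℕ → ℕ) → ℕ
  /-- The remaining arguments. -/
  rest : ι → List Arg
  /-- The number of remaining arguments. -/
  len : ℕ
  length_rest : ∀ c, (rest c).length = len

namespace Setting

variable {ι : Type} (S : Setting ι)

/-- The argument list of a setting. -/
noncomputable def args (c : ι) : List Arg := fnl existsTwo :: fnl (S.Φ c) :: S.rest c

theorem length_args (c : ι) : (S.args c).length = S.len + 2 := by
  simp [args, S.length_rest]

variable {X Y Z : Type} [Primcodable X] [Primcodable Y] [Primcodable Z]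

/-- `S.Comp g`: a single index computes the code of `g c x` from the code of `x` and the
arguments belonging to `c`. -/
def Comp (g : ι → X → Y) : Prop :=
  UComp (σ := ι × X) (fun s => num (encode s.2) :: S.args s.1) (fun s => encode (g s.1 s.2))

open Classical in
/-- `S.Dec P`: the predicate `P` is decided by a single index. -/
def Dec (P : ι → X → Prop) : Prop := S.Comp fun c x => decide (P c x)

variable {S}

theorem Comp.of_eq {f g : ι → X → Y} (hf : S.Comp f) (h : ∀ c x, f c x = g c x) : S.Comp g := by
  rwa [show g = f from funext fun c => funext fun x => (h c x).symm]

theorem Dec.of_iff {P Q : ι → X → Prop} (hP : S.Dec P) (h : ∀ c x, P c x ↔ Q c x) : S.Dec Q := by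
  rwa [show Q = P from funext fun c => funext fun x => propext (h c x).symm]

theorem Comp.comp {g : ι → Y → Z} {f : ι → X → Y} (hg : S.Comp g) (hf : S.Comp f) :
    S.Comp fun c x => g c (f c x) :=
  .push hf (.dropSecond _ (hg.reindex fun s : ι × X => (s.1, f s.1 s.2)))

theorem Dec.comp {P : ι → Y → Prop} {f : ι → X → Y} (hP : S.Dec P) (hf : S.Comp f) :
    S.Dec fun c x => P c (f c x) :=
  Comp.comp hP hf

/-- Primitive recursive maps between `Primcodable` types are computed in every setting. -/
theorem _root_.Primrec.settingComp {f : X → Y} (hf : Primrec f) : S.Comp fun _ x => f x := by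
  have h : Primrec fun n : ℕ => (encode ((Encodable.decode (α := X) n).map f)).pred :=
    Primrec.pred.comp (Primrec.encode.comp (Primrec.option_map₁ hf |>.comp Primrec.decode))
  refine (UComp.primrec₁ h (fun s : ι × X => encode s.2) fun s => S.args s.1).imp
    fun e he s => ?_
  simpa using he s

theorem Comp.const (y : Y) : S.Comp fun _ (_ : X) => y := (Primrec.const y).settingComp

theorem Comp.id : S.Comp fun _ (x : X) => x := Primrec.id.settingComp

theorem Comp.pair {f : ι → X → Y} {g : ι → X → Z} (hf : S.Comp f) (hg : S.Comp g) :
    S.Comp fun c x => (f c x, g c x) := by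
  refine .push hg (.push (x := fun s => encode (f s.1 s.2)) (.drop _ hf) ?_)
  simp only [Encodable.encode_prod_val]
  exact .primrec₂ Primrec₂.natPair _ _ _

theorem Comp.fst {f : ι → X → Y × Z} (hf : S.Comp f) : S.Comp fun c x => (f c x).1 :=
  Primrec.fst.settingComp.comp hf

theorem Comp.snd {f : ι → X → Y × Z} (hf : S.Comp f) : S.Comp fun c x => (f c x).2 :=
  Primrec.snd.settingComp.comp hf

theorem Comp.map₂ {W : Type} [Primcodable W] {p : Y → Z → W} (hp : Primrec₂ p)
    {f : ι → X → Y} {g : ι → X → Z} (hf : S.Comp f) (hg : S.Comp g) :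
    S.Comp fun c x => p (f c x) (g c x) :=
  Comp.comp (g := fun _ (y : Y × Z) => p y.1 y.2) (Primrec.settingComp hp) (hf.pair hg)

theorem Comp.map {p : Y → Z} (hp : Primrec p) {f : ι → X → Y} (hf : S.Comp f) :
    S.Comp fun c x => p (f c x) :=
  hp.settingComp.comp hf

theorem _root_.PrimrecPred.settingDec {P : X → Prop} (hP : PrimrecPred P) :
    S.Dec fun _ x => P x := by
  obtain ⟨_, h⟩ := hP
  refine h.settingComp.of_eq fun _ x => ?_
  simp

theorem Dec.rel {R : Y → Z → Prop} (hR : PrimrecRel R) {f : ι → X → Y} {g : ι → X → Z}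
    (hf : S.Comp f) (hg : S.Comp g) : S.Dec fun c x => R (f c x) (g c x) :=
  Dec.comp (P := fun _ (y : Y × Z) => R y.1 y.2) (PrimrecPred.settingDec hR) (hf.pair hg)

theorem Dec.not {P : ι → X → Prop} (hP : S.Dec P) : S.Dec fun c x => ¬P c x :=
  (Comp.map Primrec.not hP).of_eq fun _ _ => by simp

theorem Dec.and {P Q : ι → X → Prop} (hP : S.Dec P) (hQ : S.Dec Q) :
    S.Dec fun c x => P c x ∧ Q c x :=
  (Comp.map₂ Primrec.and hP hQ).of_eq fun _ _ => Bool.eq_iff_iff.2 (by simp)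

theorem Dec.or {P Q : ι → X → Prop} (hP : S.Dec P) (hQ : S.Dec Q) :
    S.Dec fun c x => P c x ∨ Q c x :=
  (Comp.map₂ Primrec.or hP hQ).of_eq fun _ _ => Bool.eq_iff_iff.2 (by simp)

theorem Dec.imp {P Q : ι → X → Prop} (hP : S.Dec P) (hQ : S.Dec Q) :
    S.Dec fun c x => P c x → Q c x :=
  (hP.not.or hQ).of_iff fun _ _ => imp_iff_not_or.symm

open Classical in
theorem Comp.ite {P : ι → X → Prop} {f g : ι → X → Y} (hP : S.Dec P) (hf : S.Comp f)
    (hg : S.Comp g) : S.Comp fun c x => if P c x then f c x else g c x := by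
  refine (Comp.map (p := fun t : Bool × Y × Y => bif t.1 then t.2.1 else t.2.2)
    (Primrec.cond Primrec.fst (Primrec.fst.comp Primrec.snd) (Primrec.snd.comp Primrec.snd))
    (Comp.pair hP (hf.pair hg))).of_eq fun c x => ?_
  by_cases h : P c x <;> simp [h]

/-- Application of `∃²` to a computed sequence. -/
theorem Comp.existsTwo {K : ι → X → ℕ → ℕ} (hK : S.Comp fun c (p : X × ℕ) => K c p.1 p.2) :
    S.Comp fun c x => existsTwo (K c x) := by
  refine .swap (.app₂ (G := fun s : ι × X => K s.1 s.2) ?_)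
  refine .push (x := fun s : (ι × X) × ℕ => Nat.pair (encode s.1.2) s.2)
    (.swap (.rotate₃ (.primrec₂ Primrec₂.natPair _ _ _))) ?_
  exact .dropThird _ (.dropThird _ (hK.reindex fun s : (ι × X) × ℕ => (s.1.1, (s.1.2, s.2))))

/-- Application of the type 2 argument `Φ` to a computed sequence. -/
theorem Comp.applyΦ {K : ι → X → ℕ → ℕ} (hK : S.Comp fun c (p : X × ℕ) => K c p.1 p.2) :
    S.Comp fun c x => S.Φ c (K c x) := by
  refine .rotate₃ (.app₂ (G := fun s : ι × X => K s.1 s.2) ?_)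
  refine .push (x := fun s : (ι × X) × ℕ => Nat.pair (encode s.1.2) s.2)
    (.swap (.rotate₃ (.primrec₂ Primrec₂.natPair _ _ _))) ?_
  exact .dropThird _ (.dropThird _ (.rotate₃ (.swap
    (hK.reindex fun s : (ι × X) × ℕ => (s.1.1, (s.1.2, s.2))))))

/-- Application of the type 1 argument. -/
theorem Comp.applyRest {α : ι → ℕ → ℕ} (hα : ∀ c, S.rest c = [fn (α c)]) {f : ι → X → ℕ}
    (hf : S.Comp f) : S.Comp fun c x => α c (f c x) := by
  refine Comp.comp (g := fun c n => α c n) ?_ hf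
  simp only [Comp, args, hα]
  exact .rotate₄ (.app₁ _ _ _)

/-- Numerical quantifiers over decided predicates are decided, thanks to `∃²`. -/
theorem Dec.ex {P : ι → X → ℕ → Prop} (hP : S.Dec fun c (p : X × ℕ) => P c p.1 p.2) :
    S.Dec fun c x => ∃ m, P c x m := by
  classical
  have h := Comp.existsTwo (K := fun c x m => if P c x m then 0 else 1)
    (Comp.of_eq (Comp.ite hP (Comp.const 0) (Comp.const 1)) fun _ _ => by congr)
  refine (Dec.rel Primrec.eq h (Comp.const 0)).of_iff fun c x => ?_
  simp [_root_.existsTwo]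

theorem Dec.all {P : ι → X → ℕ → Prop} (hP : S.Dec fun c (p : X × ℕ) => P c p.1 p.2) :
    S.Dec fun c x => ∀ m, P c x m :=
  (Dec.ex (P := fun c x m => ¬P c x m) hP.not).not.of_iff fun _ _ => by simp

/-- The least witness of a decided predicate is computed; it is `0` where there is no witness. -/
theorem Comp.least {P : ι → X → ℕ → Prop} (hP : S.Dec fun c (p : X × ℕ) => P c p.1 p.2) :
    S.Comp fun c x => sInf {m | P c x m} := by
  classical
  -- Searching for `P c x m ∨ ¬∃ m, P c x m` makes the search total.
  have hQ : S.Dec fun c (p : X × ℕ) => P c p.1 p.2 ∨ ¬∃ m, P c p.1 m :=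
    hP.or (Dec.comp (P := fun c x => ∃ m, P c x m) (Dec.ex hP) Comp.id.fst).not
  have hG : ∀ s : ι × X, ∃ m,
      (if P s.1 s.2 m ∨ ¬∃ m, P s.1 s.2 m then 0 else 1) = 0 := fun s => by
    by_cases h : ∃ m, P s.1 s.2 m
    · exact h.imp fun m hm => if_pos (.inl hm)
    · exact ⟨0, if_pos (.inr h)⟩
  refine (UComp.find (k := S.len + 3) (fun s => by simp [S.length_args])
    (A := fun s : ι × X => num (encode s.2) :: S.args s.1)
    (G := fun s m => if P s.1 s.2 m ∨ ¬∃ m, P s.1 s.2 m then 0 else 1) ?_ hG).imp fun e he s => ?_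
  · refine .push (x := fun s : (ι × X) × ℕ => Nat.pair (encode s.1.2) s.2)
      (.swap (.primrec₂ Primrec₂.natPair _ _ _)) (.dropSecond _ (.dropSecond _ ?_))
    have h : S.Comp fun c (p : X × ℕ) => if P c p.1 p.2 ∨ ¬∃ m, P c p.1 m then 0 else 1 :=
      (Comp.ite hQ (Comp.const 0) (Comp.const 1)).of_eq fun _ _ => by congr
    exact h.reindex fun s : (ι × X) × ℕ => (s.1.1, (s.1.2, s.2))
  · convert he s using 1
    show sInf {m | P s.1 s.2 m} = _
    refine ((Nat.find_eq_iff _).2 ?_).symm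
    by_cases h : ∃ m, P s.1 s.2 m
    · refine ⟨if_pos (.inl (Nat.sInf_mem (s := {m | P s.1 s.2 m}) h)), fun n hn => ?_⟩
      rw [if_neg (by simpa [h] using Nat.notMem_of_lt_sInf hn)]
      simp
    · have h0 : sInf {m | P s.1 s.2 m} = 0 := by
        rw [Nat.sInf_eq_zero]
        exact .inr (Set.eq_empty_iff_forall_notMem.2 fun m hm => h ⟨m, hm⟩)
      rw [h0]
      exact ⟨if_pos (.inr h), by simp⟩

/-- Primitive recursion with values in `ℕ` and no parameter but the context. -/
theorem Comp.natRec {a : ℕ} {step : ι → ℕ → ℕ → ℕ}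
    (h : S.Comp fun c (p : ℕ × ℕ) => step c p.1 p.2) :
    S.Comp fun c (n : ℕ) => (Nat.rec a (fun k z => step c k z) n : ℕ) := by
  have h' : UComp (σ := ι × ℕ × ℕ) (fun s => num s.2.1 :: num s.2.2 :: S.args s.1)
      (fun s => step s.1 s.2.1 s.2.2) :=
    .push (x := fun s => Nat.pair s.2.1 s.2.2) (.primrec₂ Primrec₂.natPair _ _ _)
      (.dropSecond _ (.dropSecond _ (h.reindex fun s : ι × ℕ × ℕ => s)))
  obtain ⟨e, he⟩ := h'
  refine ⟨Nat.pair 5 (Nat.pair (Nat.pair 2 a) e), fun ⟨c, n⟩ => ?_⟩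
  show Kleene _ (num n :: S.args c) _
  induction n with
  | zero => exact .s5_zero (.s2 _ _)
  | succ n ih => exact .s5_succ ih (he (c, n, _))

/-- The computation from the arguments of the setting alone. -/
theorem Comp.index₀ {g : ι → Unit → ℕ} (hg : S.Comp g) :
    ∃ e, ∀ c, Kleene e (S.args c) (g c ()) :=
  UComp.push (.const _ 0) (hg.reindex fun c : ι => (c, ()))

/-- The computation from a numerical argument that follows the arguments of the setting; likewise
for two and three numerical arguments below. -/
theorem Comp.index₁ {g : ι → ℕ → ℕ} (hg : S.Comp g) :
    ∃ e, ∀ c n, Kleene e (S.args c ++ [num n]) (g c n) := by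
  have : UComp (σ := ι × ℕ) (fun s => S.args s.1 ++ [num s.2]) (fun s => g s.1 s.2) := by
    refine .moveFront (b := fun s : ι × ℕ => S.args s.1) (c := fun _ => [])
      (fun s => S.length_args s.1) ?_
    simp only [List.append_nil]
    exact hg
  exact this.imp fun e he c n => he (c, n)

theorem Comp.index₂ {g : ι → ℕ × ℕ → ℕ} (hg : S.Comp g) :
    ∃ e, ∀ c n m, Kleene e (S.args c ++ [num n, num m]) (g c (n, m)) := by
  have : UComp (σ := ι × ℕ × ℕ) (fun s => S.args s.1 ++ [num s.2.1, num s.2.2])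
      (fun s => g s.1 s.2) := by
    refine .moveFront (b := fun s : ι × ℕ × ℕ => S.args s.1) (c := fun s => [num s.2.2])
      (fun s => S.length_args s.1) ?_
    refine .moveFront (b := fun s : ι × ℕ × ℕ => num s.2.1 :: S.args s.1) (c := fun _ => [])
      (k := S.len + 3) (fun s => by simp [S.length_args]) ?_
    simp only [List.append_nil]
    exact .push (x := fun s => Nat.pair s.2.1 s.2.2) (.swap (.primrec₂ Primrec₂.natPair _ _ _))
      (.dropSecond _ (.dropSecond _ hg))
  exact this.imp fun e he c n m => he (c, n, m)

theorem Comp.index₃ {g : ι → ℕ × ℕ × ℕ → ℕ} (hg : S.Comp g) :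
    ∃ e, ∀ c n m l, Kleene e (S.args c ++ [num n, num m, num l]) (g c (n, m, l)) := by
  have : UComp (σ := ι × ℕ × ℕ × ℕ)
      (fun s => S.args s.1 ++ [num s.2.1, num s.2.2.1, num s.2.2.2]) (fun s => g s.1 s.2) := by
    refine .moveFront (b := fun s : ι × ℕ × ℕ × ℕ => S.args s.1)
      (c := fun s => [num s.2.2.1, num s.2.2.2]) (fun s => S.length_args s.1) ?_
    refine .moveFront (b := fun s : ι × ℕ × ℕ × ℕ => num s.2.1 :: S.args s.1)
      (c := fun s => [num s.2.2.2]) (k := S.len + 3) (fun s => by simp [S.length_args]) ?_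
    refine .moveFront (b := fun s : ι × ℕ × ℕ × ℕ => num s.2.2.1 :: num s.2.1 :: S.args s.1)
      (c := fun _ => []) (k := S.len + 4) (fun s => by simp [S.length_args]) ?_
    simp only [List.append_nil]
    refine .push (x := fun s => Nat.pair s.2.2.1 s.2.2.2)
      (.swap (.primrec₂ Primrec₂.natPair _ _ _)) (.dropSecond _ (.dropSecond _ ?_))
    exact .push (x := fun s => Nat.pair s.2.1 (Nat.pair s.2.2.1 s.2.2.2))
      (.swap (.primrec₂ Primrec₂.natPair _ _ _)) (.dropSecond _ (.dropSecond _ hg))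
  exact this.imp fun e he c n m l => he (c, n, m, l)

end Setting

/-! ### Codes of rationals -/

theorem ratOf_surjective : Function.Surjective ratOf := by
  intro r
  refine ⟨Nat.pair (Nat.pair r.num.toNat (-r.num).toNat) (r.den - 1), ?_⟩
  have hd : ((r.den - 1 : ℕ) : ℚ) + 1 = r.den := by
    exact_mod_cast Nat.sub_add_cancel r.pos
  have hn : ((r.num.toNat : ℕ) : ℚ) - ((-r.num).toNat : ℕ) = r.num := by
    exact_mod_cast Int.toNat_sub_toNat_neg r.num
  simp only [ratOf, Nat.unpair_pair]
  rw [hd, hn, Rat.num_div_den]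

theorem exists_ratOf_btwn {a b : ℝ} (h : a < b) : ∃ q, a < ratOf q ∧ (ratOf q : ℝ) < b := by
  obtain ⟨r, hr⟩ := exists_rat_btwn h
  obtain ⟨q, rfl⟩ := ratOf_surjective r
  exact ⟨q, hr⟩

/-- A code of the negative of a coded rational. -/
def ratNeg (q : ℕ) : ℕ := Nat.pair (Nat.pair q.unpair.1.unpair.2 q.unpair.1.unpair.1) q.unpair.2

theorem ratOf_ratNeg (q : ℕ) : ratOf (ratNeg q) = -ratOf q := by
  simp only [ratOf, ratNeg, Nat.unpair_pair]
  ring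

theorem primrec_unpair_fst : Primrec fun n : ℕ => n.unpair.1 := Primrec.fst.comp Primrec.unpair

theorem primrec_unpair_snd : Primrec fun n : ℕ => n.unpair.2 := Primrec.snd.comp Primrec.unpair

theorem primrec_ratNeg : Primrec ratNeg :=
  Primrec₂.natPair.comp
    (Primrec₂.natPair.comp (primrec_unpair_snd.comp primrec_unpair_fst)
      (primrec_unpair_fst.comp primrec_unpair_fst)) primrec_unpair_snd

/-- A code of the sum of two coded rationals. -/
def ratAdd (p q : ℕ) : ℕ :=
  Nat.pair
    (Nat.pair (p.unpair.1.unpair.1 * (q.unpair.2 + 1) + q.unpair.1.unpair.1 * (p.unpair.2 + 1))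
      (p.unpair.1.unpair.2 * (q.unpair.2 + 1) + q.unpair.1.unpair.2 * (p.unpair.2 + 1)))
    ((p.unpair.2 + 1) * (q.unpair.2 + 1) - 1)

theorem ratOf_ratAdd (p q : ℕ) : ratOf (ratAdd p q) = ratOf p + ratOf q := by
  have h : (((p.unpair.2 + 1) * (q.unpair.2 + 1) - 1 : ℕ) : ℚ) + 1 =
      (p.unpair.2 + 1) * (q.unpair.2 + 1) := by
    exact_mod_cast Nat.sub_add_cancel (Nat.succ_le_of_lt (by positivity))
  simp only [ratOf, ratAdd, Nat.unpair_pair, h]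
  push_cast
  field_simp
  ring

theorem primrec_ratAdd : Primrec₂ ratAdd := by
  have a {g : ℕ × ℕ → ℕ} (hg : Primrec g) : Primrec fun p => (g p).unpair.1.unpair.1 :=
    primrec_unpair_fst.comp (primrec_unpair_fst.comp hg)
  have b {g : ℕ × ℕ → ℕ} (hg : Primrec g) : Primrec fun p => (g p).unpair.1.unpair.2 :=
    primrec_unpair_snd.comp (primrec_unpair_fst.comp hg)
  have d {g : ℕ × ℕ → ℕ} (hg : Primrec g) : Primrec fun p => (g p).unpair.2 + 1 :=
    Primrec.succ.comp (primrec_unpair_snd.comp hg)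
  have m {g h : ℕ × ℕ → ℕ} (hg : Primrec g) (hh : Primrec h) : Primrec fun p => g p * h p :=
    Primrec.nat_mul.comp hg hh
  exact Primrec₂.natPair.comp
    (Primrec₂.natPair.comp
      (Primrec.nat_add.comp (m (a .fst) (d .snd)) (m (a .snd) (d .fst)))
      (Primrec.nat_add.comp (m (b .fst) (d .snd)) (m (b .snd) (d .fst))))
    (Primrec.pred.comp (m (d .fst) (d .snd)))

/-- A code of `2⁻ⁿ`. -/
def ratPow (n : ℕ) : ℕ := Nat.pair (Nat.pair 1 0) (2 ^ n - 1)

theorem ratOf_ratPow (n : ℕ) : ratOf (ratPow n) = 1 / 2 ^ n := by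
  have h : ((2 ^ n - 1 : ℕ) : ℚ) + 1 = 2 ^ n := by
    exact_mod_cast Nat.sub_add_cancel (Nat.one_le_two_pow)
  simp only [ratOf, ratPow, Nat.unpair_pair, h]
  norm_num

theorem primrec_ratPow : Primrec ratPow := by
  have h : Primrec fun n : ℕ => 2 ^ n :=
    (Primrec.nat_rec₁ (f := fun _ z => 2 * z) 1
      (Primrec.nat_double.comp Primrec.snd).to₂).of_eq fun n => by
      induction n with
      | zero => rfl
      | succ n ih => simp only [ih, pow_succ]; ring
  exact Primrec₂.natPair.comp (Primrec.const _) (Primrec.pred.comp h)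

theorem primrec_ratOf_lt : PrimrecRel fun p q : ℕ => ratOf p < ratOf q := by
  have a {g : ℕ × ℕ → ℕ} (hg : Primrec g) : Primrec fun p => (g p).unpair.1.unpair.1 :=
    primrec_unpair_fst.comp (primrec_unpair_fst.comp hg)
  have b {g : ℕ × ℕ → ℕ} (hg : Primrec g) : Primrec fun p => (g p).unpair.1.unpair.2 :=
    primrec_unpair_snd.comp (primrec_unpair_fst.comp hg)
  have d {g : ℕ × ℕ → ℕ} (hg : Primrec g) : Primrec fun p => (g p).unpair.2 + 1 :=
    Primrec.succ.comp (primrec_unpair_snd.comp hg)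
  have m {g h : ℕ × ℕ → ℕ} (hg : Primrec g) (hh : Primrec h) : Primrec fun p => g p * h p :=
    Primrec.nat_mul.comp hg hh
  refine (Primrec.nat_lt.comp
    (Primrec.nat_add.comp (m (a .fst) (d .snd)) (m (b .snd) (d .fst)))
    (Primrec.nat_add.comp (m (a .snd) (d .fst)) (m (b .fst) (d .snd)))).of_eq fun ⟨p, q⟩ => ?_
  simp only [ratOf]
  rw [div_lt_div_iff₀ (by positivity) (by positivity), ← Nat.cast_lt (α := ℚ)]
  push_cast
  constructor <;> intro h <;> linarith

/-! ### Names of real numbers -/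

/-- The canonical name of a real number: its entries are least codes. -/
noncomputable def nameOf (v : ℝ) (n : ℕ) : ℕ := sInf {m | |(ratOf m : ℝ) - v| ≤ 1 / 2 ^ n}

theorem names_nameOf (v : ℝ) : Names (nameOf v) v := by
  intro n
  refine Nat.sInf_mem (s := {m | |(ratOf m : ℝ) - v| ≤ 1 / 2 ^ n}) ?_
  have hn : (0 : ℝ) < 1 / 2 ^ n := by positivity
  obtain ⟨q, h₁, h₂⟩ := exists_ratOf_btwn (show v < v + 1 / 2 ^ n by linarith)
  refine ⟨q, ?_⟩
  show |(ratOf q : ℝ) - v| ≤ 1 / 2 ^ n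
  exact abs_le.2 ⟨by linarith, by linarith⟩

/-- A name enumerates the lower cut of its real. -/
theorem Names.lt_iff {α : ℕ → ℕ} {v : ℝ} (h : Names α v) (r : ℝ) :
    r < v ↔ ∃ n, r + 1 / 2 ^ n < (ratOf (α n) : ℝ) := by
  constructor
  · intro hr
    obtain ⟨n, hn⟩ := exists_pow_lt_of_lt_one (show 0 < (v - r) / 2 by linarith)
      (show (1 / 2 : ℝ) < 1 by norm_num)
    rw [one_div_pow] at hn
    have := (abs_le.1 (h n)).1
    exact ⟨n, by linarith⟩
  · rintro ⟨n, hn⟩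
    have := (abs_le.1 (h n)).2
    linarith

/-! ### Reals with decided cuts -/

namespace Setting

variable {ι : Type} {S : Setting ι}
variable {X Y Z : Type} [Primcodable X] [Primcodable Y] [Primcodable Z]

variable (S) in
/-- `S.Cut v`: the lower cut of the real `v c x` is decided.  In the presence of `∃²` this amounts
to the computability of names; unlike a name, the cut depends on the real alone. -/
def Cut (v : ι → X → ℝ) : Prop := S.Dec fun c (p : X × ℕ) => (ratOf p.2 : ℝ) < v c p.1

variable (S) in
/-- `S.ECut v`: the lower cut of the extended real `v c x` is decided. -/
def ECut (v : ι → X → EReal) : Prop :=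
  S.Dec fun c (p : X × ℕ) => ((ratOf p.2 : ℝ) : EReal) < v c p.1

theorem Cut.of_eq {u v : ι → X → ℝ} (hu : S.Cut u) (h : ∀ c x, u c x = v c x) : S.Cut v := by
  rwa [show v = u from funext fun c => funext fun x => (h c x).symm]

theorem Cut.comp {v : ι → Y → ℝ} {g : ι → X → Y} (hv : S.Cut v) (hg : S.Comp g) :
    S.Cut fun c x => v c (g c x) :=
  Dec.comp (P := fun c (p : Y × ℕ) => (ratOf p.2 : ℝ) < v c p.1)
    (f := fun c (p : X × ℕ) => (g c p.1, p.2)) hv ((hg.comp Comp.id.fst).pair Comp.id.snd)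

theorem Cut.ofCode {g : ι → X → ℕ} (hg : S.Comp g) : S.Cut fun c x => (ratOf (g c x) : ℝ) :=
  (Dec.rel primrec_ratOf_lt Comp.id.snd (hg.comp Comp.id.fst)).of_iff fun _ _ => by
    simp

theorem Cut.rat (r : ℚ) : S.Cut fun _ (_ : X) => (r : ℝ) := by
  obtain ⟨q, rfl⟩ := ratOf_surjective r
  exact Cut.ofCode (Comp.const q)

theorem Cut.pow {g : ι → X → ℕ} (hg : S.Comp g) : S.Cut fun c x => 1 / 2 ^ g c x :=
  (Cut.ofCode (hg.map primrec_ratPow)).of_eq fun _ _ => by simp [ratOf_ratPow]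

theorem Cut.pow_succ {g : ι → X → ℕ} (hg : S.Comp g) : S.Cut fun c x => 1 / 2 ^ (g c x + 1) :=
  Cut.pow (hg.map Primrec.succ)

/-- The comparison of a coded rational with a real whose cut is decided. -/
theorem Cut.code_lt {v : ι → X → ℝ} (hv : S.Cut v) {g : ι → X → ℕ} (hg : S.Comp g) :
    S.Dec fun c x => (ratOf (g c x) : ℝ) < v c x :=
  Dec.comp (P := fun c (p : X × ℕ) => (ratOf p.2 : ℝ) < v c p.1)
    (f := fun c x => (x, g c x)) hv (Comp.id.pair hg)

theorem Cut.lt {u v : ι → X → ℝ} (hu : S.Cut u) (hv : S.Cut v) : S.Dec fun c x => u c x < v c x :=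
  (Dec.ex (P := fun c x q => ¬(ratOf q : ℝ) < u c x ∧ (ratOf q : ℝ) < v c x)
    ((Dec.not hu).and hv)).of_iff fun c x => by
    constructor
    · rintro ⟨q, h₁, h₂⟩
      exact (not_lt.1 h₁).trans_lt h₂
    · intro h
      obtain ⟨q, h₁, h₂⟩ := exists_ratOf_btwn h
      exact ⟨q, h₁.not_gt, h₂⟩

theorem Cut.le {u v : ι → X → ℝ} (hu : S.Cut u) (hv : S.Cut v) : S.Dec fun c x => u c x ≤ v c x :=
  (hv.lt hu).not.of_iff fun _ _ => not_lt

theorem Cut.neg {v : ι → X → ℝ} (hv : S.Cut v) : S.Cut fun c x => -v c x :=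
  ((hv.comp Comp.id.fst).lt (Cut.ofCode (Comp.id.snd.map primrec_ratNeg))).of_iff fun c p => by
    rw [ratOf_ratNeg]
    push_cast
    exact lt_neg

theorem Cut.add {u v : ι → X → ℝ} (hu : S.Cut u) (hv : S.Cut v) :
    S.Cut fun c x => u c x + v c x := by
  have h : S.Dec fun c (p : X × ℕ) => ∃ r s : ℕ, (ratOf r : ℝ) < u c p.1 ∧
      (ratOf s : ℝ) < v c p.1 ∧ ratOf p.2 < ratOf (ratAdd r s) :=
    Dec.ex (Dec.ex (((hu.comp Comp.id.fst.fst.fst).code_lt Comp.id.fst.snd).and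
      (((hv.comp Comp.id.fst.fst.fst).code_lt Comp.id.snd).and
        (Dec.rel primrec_ratOf_lt Comp.id.fst.fst.snd
          (Comp.map₂ primrec_ratAdd Comp.id.fst.snd Comp.id.snd)))))
  refine h.of_iff fun c p => ?_
  simp only [ratOf_ratAdd]
  constructor
  · rintro ⟨r, s, hr, hs, h⟩
    have : (ratOf p.2 : ℝ) < ratOf r + ratOf s := by exact_mod_cast h
    linarith
  · intro h
    set d := u c p.1 + v c p.1 - ratOf p.2 with hd
    have hd0 : 0 < d := by linarith
    obtain ⟨r, hr, hr'⟩ := exists_ratOf_btwn (show u c p.1 - d / 2 < u c p.1 by linarith)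
    obtain ⟨s, hs, hs'⟩ := exists_ratOf_btwn (show v c p.1 - d / 2 < v c p.1 by linarith)
    refine ⟨r, s, hr', hs', ?_⟩
    have : (ratOf p.2 : ℝ) < ratOf r + ratOf s := by linarith
    exact_mod_cast this

theorem Cut.sub {u v : ι → X → ℝ} (hu : S.Cut u) (hv : S.Cut v) :
    S.Cut fun c x => u c x - v c x :=
  (hu.add hv.neg).of_eq fun _ _ => (sub_eq_add_neg _ _).symm

theorem Cut.max {u v : ι → X → ℝ} (hu : S.Cut u) (hv : S.Cut v) :
    S.Cut fun c x => max (u c x) (v c x) :=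
  (Dec.or hu hv).of_iff fun _ _ => lt_max_iff.symm

theorem Cut.min {u v : ι → X → ℝ} (hu : S.Cut u) (hv : S.Cut v) :
    S.Cut fun c x => min (u c x) (v c x) :=
  (Dec.and hu hv).of_iff fun _ _ => lt_min_iff.symm

theorem Cut.abs {v : ι → X → ℝ} (hv : S.Cut v) : S.Cut fun c x => |v c x| := hv.max hv.neg

/-- `∃²` turns computed names into decided cuts. -/
theorem Cut.of_names {v : ι → X → ℝ} {β : ι → X → ℕ → ℕ} (hv : ∀ c x, Names (β c x) (v c x))
    (hβ : S.Comp fun c (p : X × ℕ) => β c p.1 p.2) : S.Cut v :=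
  (Dec.ex (P := fun c (p : X × ℕ) n =>
      (ratOf p.2 : ℝ) + 1 / 2 ^ n < ratOf (β c p.1 n))
    (Cut.lt ((Cut.ofCode Comp.id.fst.snd).add (Cut.pow Comp.id.snd))
      (Cut.ofCode (Comp.comp hβ (Comp.id.fst.fst.pair Comp.id.snd))))).of_iff fun c p =>
    ((hv c p.1).lt_iff _).symm

/-- Conversely, canonical names are computed from decided cuts. -/
theorem Cut.comp_nameOf {v : ι → X → ℝ} (hv : S.Cut v) :
    S.Comp fun c (p : X × ℕ) => nameOf (v c p.1) p.2 :=
  Comp.least (P := fun c (p : X × ℕ) m => |(ratOf m : ℝ) - v c p.1| ≤ 1 / 2 ^ p.2)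
    (Cut.le (((Cut.ofCode Comp.id.snd).sub (hv.comp Comp.id.fst.fst)).abs)
      (Cut.pow Comp.id.fst.snd))

/-- The value of a represented function at a computed point. -/
theorem Cut.apply {f : ι → Icc (0 : ℝ) 1 → ℝ} (hf : ∀ c, Represents (S.Φ c) (f c))
    {y : ι → X → Icc (0 : ℝ) 1} (hy : S.Cut fun c x => (y c x : ℝ)) :
    S.Cut fun c x => f c (y c x) := by
  refine Cut.of_names
    (β := fun c x n => S.Φ c (consSeq n (nameOf (y c x))))
    (fun c x => hf c _ _ (names_nameOf _)) (Comp.applyΦ ?_)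
  have h : S.Comp fun c (p : (X × ℕ) × ℕ) =>
      if p.2 = 0 then p.1.2 else nameOf (y c p.1.1) (p.2 - 1) :=
    (Comp.ite (Dec.rel Primrec.eq Comp.id.snd (Comp.const 0)) Comp.id.fst.snd
      (Comp.comp hy.comp_nameOf (Comp.id.fst.fst.pair (Comp.id.snd.map Primrec.pred)))).of_eq
      fun _ _ => by congr
  refine h.of_eq fun c p => ?_
  obtain ⟨⟨x, n⟩, i⟩ := p
  cases i <;> rfl

theorem Cut.computesReal₀ {v : ι → Unit → ℝ} (hv : S.Cut v) :
    ∃ e, ∀ c, ComputesReal e (S.args c) (v c ()) := by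
  obtain ⟨e, he⟩ := (Comp.comp (f := fun _ (n : ℕ) => ((), n)) hv.comp_nameOf
    ((Comp.const ()).pair Comp.id)).index₁
  exact ⟨e, fun c => ⟨_, names_nameOf _, he c⟩⟩

theorem Cut.computesReal₁ {v : ι → ℕ → ℝ} (hv : S.Cut v) :
    ∃ e, ∀ c n, ComputesReal e (S.args c ++ [num n]) (v c n) := by
  obtain ⟨e, he⟩ := hv.comp_nameOf.index₂
  exact ⟨e, fun c n => ⟨_, names_nameOf _, fun m => by simpa using he c n m⟩⟩

open Classical in
/-- The canonical name of an extended real above `-∞`. -/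
noncomputable def _root_.nameOfExt (v : EReal) (n : ℕ) : ℕ :=
  if v = ⊤ then 1 else if n = 0 then 0 else nameOf v.toReal (n - 1)

theorem _root_.namesExt_nameOfExt {v : EReal} (hv : v ≠ ⊥) : NamesExt (nameOfExt v) v := by
  by_cases h : v = ⊤
  · exact .inr ⟨by simp [nameOfExt, h], h⟩
  · refine .inl ⟨by simp [nameOfExt, h], v.toReal, (EReal.coe_toReal h hv).symm, ?_⟩
    simpa [nameOfExt, h] using names_nameOf v.toReal

theorem ECut.comp_nameOfExt {v : ι → X → EReal} (hv : S.ECut v) (hbot : ∀ c x, v c x ≠ ⊥) :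
    S.Comp fun c (p : X × ℕ) => nameOfExt (v c p.1) p.2 := by
  have htop : S.Dec fun c x => v c x = ⊤ := by
    refine (Dec.all (P := fun c x q => ((ratOf q : ℝ) : EReal) < v c x) hv).of_iff fun c x => ?_
    constructor
    · intro h
      rw [EReal.eq_top_iff_forall_lt]
      intro y
      obtain ⟨q, hq, -⟩ := exists_ratOf_btwn (lt_add_one y)
      exact (EReal.coe_lt_coe_iff.2 hq).trans (h q)
    · intro h q
      rw [h]
      exact EReal.coe_lt_top _
  have hreal : S.Cut fun c x => (v c x).toReal := by
    refine ((htop.comp Comp.id.fst).and (Cut.lt (Cut.ofCode Comp.id.snd) (Cut.rat 0)) |>.or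
      ((htop.comp Comp.id.fst).not.and hv)).of_iff fun c p => ?_
    by_cases h : v c p.1 = ⊤
    · simp [h]
    · simp only [h, false_and, not_false_eq_true, true_and, false_or]
      conv_lhs => rw [← EReal.coe_toReal h (hbot c p.1)]
      exact EReal.coe_lt_coe_iff
  refine (Comp.ite (htop.comp Comp.id.fst) (Comp.const 1)
    (Comp.ite (Dec.rel Primrec.eq Comp.id.snd (Comp.const 0)) (Comp.const 0)
      (Comp.comp hreal.comp_nameOf (Comp.id.fst.pair (Comp.id.snd.map Primrec.pred))))).of_eq
    fun c p => ?_
  simp only [nameOfExt]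
  congr

theorem ECut.computesExt₀ {v : ι → Unit → EReal} (hv : S.ECut v) (hbot : ∀ c x, v c x ≠ ⊥) :
    ∃ e, ∀ c, ComputesExt e (S.args c) (v c ()) := by
  obtain ⟨e, he⟩ := (Comp.comp (f := fun _ (n : ℕ) => ((), n)) (hv.comp_nameOfExt hbot)
    ((Comp.const ()).pair Comp.id)).index₁
  exact ⟨e, fun c => ⟨_, namesExt_nameOfExt (hbot _ _), he c⟩⟩

theorem ECut.computesExt₂ {v : ι → ℕ × ℕ → EReal} (hv : S.ECut v) (hbot : ∀ c x, v c x ≠ ⊥) :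
    ∃ e, ∀ c n m, ComputesExt e (S.args c ++ [num n, num m]) (v c (n, m)) := by
  obtain ⟨e, he⟩ := (Comp.comp (f := fun _ (p : ℕ × ℕ × ℕ) => ((p.1, p.2.1), p.2.2))
    (hv.comp_nameOfExt hbot)
    ((Comp.id.fst.pair Comp.id.snd.fst).pair Comp.id.snd.snd)).index₃
  exact ⟨e, fun c n m => ⟨_, namesExt_nameOfExt (hbot _ _), fun l => by simpa using he c n m l⟩⟩

end Setting

/-! ### Quasi-continuous functions are controlled by their values at rational points -/

/-- The dense sequence of all rational points of `[0,1]`, with codes of other rationals sent to the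
nearest end point. -/
noncomputable def unitPoint (q : ℕ) : Icc (0 : ℝ) 1 := projIcc 0 1 zero_le_one (ratOf q : ℝ)

theorem unitPoint_coe {q : ℕ} (h₀ : 0 ≤ ratOf q) (h₁ : ratOf q ≤ 1) :
    (unitPoint q : ℝ) = ratOf q := by
  rw [unitPoint, projIcc_of_mem zero_le_one (x := (ratOf q : ℝ))
    ⟨by exact_mod_cast h₀, by exact_mod_cast h₁⟩]

theorem denseRange_unitPoint : DenseRange unitPoint :=
  (projIcc_surjective zero_le_one).denseRange.comp
    (Rat.denseRange_cast.comp ratOf_surjective.denseRange Rat.continuous_coe_real)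
    continuous_projIcc

theorem QuasiContinuous.exists_unitPoint {f : Icc (0 : ℝ) 1 → ℝ} (hf : QuasiContinuous f)
    {U : Set (Icc (0 : ℝ) 1)} (hU : IsOpen U) {y : Icc (0 : ℝ) 1} (hy : y ∈ U) {ε : ℝ}
    (hε : 0 < ε) : ∃ i, unitPoint i ∈ U ∧ |f y - f (unitPoint i)| < ε := by
  obtain ⟨G, hG, hne, hGU, h⟩ := hf y ε hε U hU hy
  obtain ⟨i, hi⟩ := denseRange_unitPoint.exists_mem_open hG hne
  exact ⟨i, hGU hi, h _ hi⟩

/-- If `f` maps the rational points of an open set into a closed set, it does so with all points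
of the open set. -/
theorem QuasiContinuous.mem_of_unitPoint {f : Icc (0 : ℝ) 1 → ℝ} (hf : QuasiContinuous f)
    {U : Set (Icc (0 : ℝ) 1)} (hU : IsOpen U) {K : Set ℝ} (hK : IsClosed K)
    (h : ∀ i, unitPoint i ∈ U → f (unitPoint i) ∈ K) {y : Icc (0 : ℝ) 1} (hy : y ∈ U) :
    f y ∈ K := by
  rw [← hK.closure_eq, Metric.mem_closure_iff]
  intro ε hε
  obtain ⟨i, hi, hlt⟩ := hf.exists_unitPoint hU hy hε
  exact ⟨_, h i hi, hlt⟩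

/-- The values of `f` on `U` differ by at most `2⁻ⁿ`. -/
def SmallOsc (f : Icc (0 : ℝ) 1 → ℝ) (U : Set (Icc (0 : ℝ) 1)) (n : ℕ) : Prop :=
  ∀ y ∈ U, ∀ z ∈ U, |f y - f z| ≤ 1 / 2 ^ n

theorem QuasiContinuous.dist_le_of_unitPoint {f : Icc (0 : ℝ) 1 → ℝ} (hf : QuasiContinuous f)
    {U : Set (Icc (0 : ℝ) 1)} (hU : IsOpen U) {a r : ℝ}
    (h : ∀ i, unitPoint i ∈ U → |a - f (unitPoint i)| ≤ r) {y : Icc (0 : ℝ) 1} (hy : y ∈ U) :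
    |a - f y| ≤ r :=
  hf.mem_of_unitPoint (K := {v | |a - v| ≤ r}) hU
    (isClosed_le (by fun_prop) continuous_const) h hy

theorem QuasiContinuous.smallOsc_iff {f : Icc (0 : ℝ) 1 → ℝ} (hf : QuasiContinuous f)
    {U : Set (Icc (0 : ℝ) 1)} (hU : IsOpen U) (n : ℕ) :
    SmallOsc f U n ↔ ∀ i j, unitPoint i ∈ U → unitPoint j ∈ U →
      |f (unitPoint i) - f (unitPoint j)| ≤ 1 / 2 ^ n := by
  refine ⟨fun h i j hi hj => h _ hi _ hj, fun h y hy z hz => ?_⟩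
  refine hf.dist_le_of_unitPoint hU (fun j hj => ?_) hz
  rw [abs_sub_comm]
  refine hf.dist_le_of_unitPoint hU (fun i hi => ?_) hy
  rw [abs_sub_comm]
  exact h i j hi hj

theorem one_div_two_pow_lt {ε : ℝ} (hε : 0 < ε) : ∃ n : ℕ, (1 : ℝ) / 2 ^ n < ε := by
  obtain ⟨n, hn⟩ := exists_pow_lt_of_lt_one hε (show (1 / 2 : ℝ) < 1 by norm_num)
  exact ⟨n, by rwa [one_div_pow] at hn⟩

theorem mem_contSet_of_smallOsc {f : Icc (0 : ℝ) 1 → ℝ} {x : Icc (0 : ℝ) 1}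
    (h : ∀ n, ∃ U, IsOpen U ∧ x ∈ U ∧ SmallOsc f U n) : x ∈ contSet f := by
  refine Metric.tendsto_nhds.2 fun ε hε => ?_
  obtain ⟨n, hn⟩ := one_div_two_pow_lt hε
  obtain ⟨U, hU, hx, hs⟩ := h n
  filter_upwards [hU.mem_nhds hx] with y hy
  exact (hs y hy x hx).trans_lt hn

theorem exists_ball_smallOsc {f : Icc (0 : ℝ) 1 → ℝ} {x : Icc (0 : ℝ) 1} (hx : x ∈ contSet f)
    (n : ℕ) : ∃ k : ℕ, SmallOsc f (Metric.ball x (1 / 2 ^ k)) n := by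
  obtain ⟨δ, hδ, h⟩ := Metric.tendsto_nhds_nhds.1 hx (1 / 2 ^ (n + 1)) (by positivity)
  obtain ⟨k, hk⟩ := one_div_two_pow_lt hδ
  refine ⟨k, fun y hy z hz => ?_⟩
  have h₁ := h ((Metric.mem_ball.1 hy).trans hk)
  have h₂ := h ((Metric.mem_ball.1 hz).trans hk)
  have h₃ : (1 : ℝ) / 2 ^ n = 1 / 2 ^ (n + 1) + 1 / 2 ^ (n + 1) := by field_simp; ring
  have := dist_triangle_right (f y) (f z) (f x)
  rw [← Real.dist_eq, h₃]
  linarith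

theorem mem_contSet_iff {f : Icc (0 : ℝ) 1 → ℝ} {x : Icc (0 : ℝ) 1} :
    x ∈ contSet f ↔ ∀ n, ∃ k : ℕ, SmallOsc f (Metric.ball x (1 / 2 ^ k)) n :=
  ⟨exists_ball_smallOsc, fun h => mem_contSet_of_smallOsc fun n => 
    let ⟨_, hk⟩ := h n
    ⟨_, Metric.isOpen_ball, Metric.mem_ball_self (by positivity), hk⟩⟩

/-- The relatively open interval of `[0,1]` between the rationals coded by `m`. -/
def unitIoo (m : ℕ) : Set (Icc (0 : ℝ) 1) :=
  {y | ((ratPairOf m).1 : ℝ) < y ∧ (y : ℝ) < (ratPairOf m).2}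

theorem isOpen_unitIoo (m : ℕ) : IsOpen (unitIoo m) :=
  (isOpen_lt continuous_const continuous_subtype_val).inter
    (isOpen_lt continuous_subtype_val continuous_const)

theorem exists_ratPairOf (p : ℚ × ℚ) : ∃ m, ratPairOf m = p := by
  obtain ⟨a, ha⟩ := ratOf_surjective p.1
  obtain ⟨b, hb⟩ := ratOf_surjective p.2
  exact ⟨Nat.pair a b, by simp [ratPairOf, ha, hb]⟩

/-- A non-empty open subset of `[0,1]` contains a non-degenerate closed rational interval. -/
theorem exists_rat_Icc_subset {G : Set (Icc (0 : ℝ) 1)} (hG : IsOpen G) (hne : G.Nonempty) :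
    ∃ m, (ratPairOf m).1 < (ratPairOf m).2 ∧
      ∀ y : ℝ, ((ratPairOf m).1 : ℝ) ≤ y → y ≤ (ratPairOf m).2 → ∃ h : y ∈ Icc (0 : ℝ) 1,
        (⟨y, h⟩ : Icc (0 : ℝ) 1) ∈ G := by
  obtain ⟨O, hO, rfl⟩ := isOpen_induced_iff.1 hG
  obtain ⟨y, hy⟩ := hne
  have hcl : (y : ℝ) ∈ closure (Ioo (0 : ℝ) 1) := by
    rw [closure_Ioo zero_ne_one]
    exact y.2
  obtain ⟨z, hzO, hz⟩ := mem_closure_iff.1 hcl O hO hy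
  obtain ⟨a, b, hab, hsub⟩ := (mem_nhds_iff_exists_Ioo_subset.1
    ((hO.inter isOpen_Ioo).mem_nhds ⟨hzO, hz⟩))
  obtain ⟨p, hp₁, hp₂⟩ := exists_rat_btwn hab.1
  obtain ⟨q, hq₁, hq₂⟩ := exists_rat_btwn hab.2
  obtain ⟨m, hm⟩ := exists_ratPairOf (p, q)
  refine ⟨m, ?_, fun w h₁ h₂ => ?_⟩
  · rw [hm]
    exact_mod_cast hp₂.trans hq₁
  · rw [hm] at h₁ h₂
    have := hsub ⟨hp₁.trans_le h₁, h₂.trans_lt hq₂⟩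
    exact ⟨Ioo_subset_Icc_self this.2, this.1⟩

/-! ### A canonical continuity point -/

/-- `m` codes an interval that is compactly contained in the one coded by `l` and on which `f`
oscillates by at most `2⁻ⁿ`. -/
def Shrinks (f : Icc (0 : ℝ) 1 → ℝ) (n l m : ℕ) : Prop :=
  (ratPairOf l).1 < (ratPairOf m).1 ∧ (ratPairOf m).1 < (ratPairOf m).2 ∧
    (ratPairOf m).2 < (ratPairOf l).2 ∧ SmallOsc f (unitIoo m) n

/-- A code of the pair `(0, 1)`. -/
def codeUnit : ℕ := Nat.pair (Nat.pair 0 0) (Nat.pair (Nat.pair 1 0) 0)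

theorem ratPairOf_codeUnit : ratPairOf codeUnit = (0, 1) := by
  simp [codeUnit, ratPairOf, ratOf]

/-- A nested sequence of codes of intervals on which `f` oscillates less and less. -/
noncomputable def nested (f : Icc (0 : ℝ) 1 → ℝ) (n : ℕ) : ℕ :=
  Nat.rec codeUnit (fun k l => sInf {m | Shrinks f k l m}) n

/-- The supremum of the left end points of `nested f`; for quasi-continuous `f` it is a continuity
point of `f`. -/
noncomputable def contPoint (f : Icc (0 : ℝ) 1 → ℝ) : ℝ :=
  ⨆ n, ((ratPairOf (nested f n)).1 : ℝ)

/-- Every interval contains one of small oscillation, by quasi-continuity at any interior point. -/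
theorem QuasiContinuous.exists_shrinks {f : Icc (0 : ℝ) 1 → ℝ} (hf : QuasiContinuous f) (n : ℕ)
    {l : ℕ} (h₀ : 0 ≤ (ratPairOf l).1) (hl : (ratPairOf l).1 < (ratPairOf l).2)
    (h₁ : (ratPairOf l).2 ≤ 1) : ∃ m, Shrinks f n l m := by
  obtain ⟨c, hc₁, hc₂⟩ := exists_between hl
  have hc : (c : ℝ) ∈ Icc (0 : ℝ) 1 :=
    ⟨by exact_mod_cast (h₀.trans_lt hc₁).le, by exact_mod_cast (hc₂.trans_le h₁).le⟩
  obtain ⟨G, hG, hne, hGU, h⟩ := hf ⟨c, hc⟩ (1 / 2 ^ (n + 1)) (by positivity) (unitIoo l)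
    (isOpen_unitIoo l) ⟨Rat.cast_lt.2 hc₁, Rat.cast_lt.2 hc₂⟩
  obtain ⟨m, hm, hsub⟩ := exists_rat_Icc_subset hG hne
  have hm' : ((ratPairOf m).1 : ℝ) ≤ (ratPairOf m).2 := by exact_mod_cast hm.le
  obtain ⟨_, hleft⟩ := hsub _ le_rfl hm'
  obtain ⟨_, hright⟩ := hsub _ hm' le_rfl
  refine ⟨m, Rat.cast_lt.1 (hGU hleft).1, hm, Rat.cast_lt.1 (hGU hright).2,
    fun y hy z hz => ?_⟩
  obtain ⟨_, hy'⟩ := hsub y hy.1.le hy.2.le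
  obtain ⟨_, hz'⟩ := hsub z hz.1.le hz.2.le
  have h₃ : (1 : ℝ) / 2 ^ n = 1 / 2 ^ (n + 1) + 1 / 2 ^ (n + 1) := by field_simp; ring
  have := abs_sub_le (f y) (f ⟨c, hc⟩) (f z)
  have h₄ := h _ hy'
  rw [abs_sub_comm] at h₄
  have h₅ := h _ hz'
  rw [h₃]
  exact this.trans (add_le_add h₄.le h₅.le)

theorem QuasiContinuous.nested_spec {f : Icc (0 : ℝ) 1 → ℝ} (hf : QuasiContinuous f) (n : ℕ) :
    (0 ≤ (ratPairOf (nested f n)).1 ∧ (ratPairOf (nested f n)).1 < (ratPairOf (nested f n)).2 ∧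
      (ratPairOf (nested f n)).2 ≤ 1) ∧ Shrinks f n (nested f n) (nested f (n + 1)) := by
  have step {n : ℕ} (h : 0 ≤ (ratPairOf (nested f n)).1 ∧
      (ratPairOf (nested f n)).1 < (ratPairOf (nested f n)).2 ∧
      (ratPairOf (nested f n)).2 ≤ 1) : Shrinks f n (nested f n) (nested f (n + 1)) :=
    Nat.sInf_mem (s := {m | Shrinks f n (nested f n) m}) (hf.exists_shrinks n h.1 h.2.1 h.2.2)
  suffices h : _ from ⟨h, step h⟩
  induction n with
  | zero => simp [nested, ratPairOf_codeUnit]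
  | succ n ih =>
    have := step ih
    exact ⟨(ih.1.trans_lt this.1).le, this.2.1, (this.2.2.1.trans_le ih.2.2).le⟩

theorem QuasiContinuous.contPoint_spec {f : Icc (0 : ℝ) 1 → ℝ} (hf : QuasiContinuous f) (n : ℕ) :
    ((ratPairOf (nested f n)).1 : ℝ) < contPoint f ∧
      contPoint f < ((ratPairOf (nested f n)).2 : ℝ) := by
  have hmono : StrictMono fun n => (ratPairOf (nested f n)).1 :=
    strictMono_nat_of_lt_succ fun n => (hf.nested_spec n).2.1
  have hanti : StrictAnti fun n => (ratPairOf (nested f n)).2 :=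
    strictAnti_nat_of_succ_lt fun n => (hf.nested_spec n).2.2.2.1
  have hlt (k m : ℕ) : (ratPairOf (nested f k)).1 < (ratPairOf (nested f m)).2 :=
    (hmono.monotone (le_max_left k m)).trans_lt
      ((hf.nested_spec (max k m)).1.2.1.trans_le (hanti.antitone (le_max_right k m)))
  have hbdd : BddAbove (range fun n => ((ratPairOf (nested f n)).1 : ℝ)) :=
    ⟨(ratPairOf (nested f 0)).2, by
      rintro _ ⟨k, rfl⟩
      exact Rat.cast_le.2 (hlt k 0).le⟩
  constructor
  · refine lt_of_lt_of_le ?_ (le_ciSup hbdd (n + 1))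
    exact_mod_cast hmono n.lt_succ_self
  · refine lt_of_le_of_lt (b := ((ratPairOf (nested f (n + 1))).2 : ℝ)) (ciSup_le fun k => ?_) ?_
    · exact_mod_cast (hlt k (n + 1)).le
    · exact_mod_cast hanti n.lt_succ_self

theorem QuasiContinuous.contPoint_pos {f : Icc (0 : ℝ) 1 → ℝ} (hf : QuasiContinuous f) :
    0 < contPoint f := by
  simpa [nested, ratPairOf_codeUnit] using (hf.contPoint_spec 0).1

theorem QuasiContinuous.contPoint_lt_one {f : Icc (0 : ℝ) 1 → ℝ} (hf : QuasiContinuous f) :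
    contPoint f < 1 := by
  simpa [nested, ratPairOf_codeUnit] using (hf.contPoint_spec 0).2

theorem QuasiContinuous.contPoint_mem {f : Icc (0 : ℝ) 1 → ℝ} (hf : QuasiContinuous f) :
    contPoint f ∈ Icc (0 : ℝ) 1 := ⟨hf.contPoint_pos.le, hf.contPoint_lt_one.le⟩

theorem QuasiContinuous.contPoint_mem_contSet {f : Icc (0 : ℝ) 1 → ℝ} (hf : QuasiContinuous f) :
    ⟨contPoint f, hf.contPoint_mem⟩ ∈ contSet f :=
  mem_contSet_of_smallOsc fun n => ⟨_, isOpen_unitIoo (nested f (n + 1)),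
    hf.contPoint_spec (n + 1), (hf.nested_spec n).2.2.2.2⟩

/-! ### Balls of small oscillation -/

theorem isOpen_rat_ball (m : ℕ) :
    IsOpen {y : Icc (0 : ℝ) 1 | |(y : ℝ) - (ratPairOf m).1| < (ratPairOf m).2} :=
  isOpen_lt (by fun_prop) continuous_const

/-- `m` codes a ball, given by centre and radius, on which `f` oscillates by at most `2⁻ⁿ`. -/
def IsSmallBall (f : Icc (0 : ℝ) 1 → ℝ) (n m : ℕ) : Prop :=
  0 < (ratPairOf m).2 ∧
    SmallOsc f {y : Icc (0 : ℝ) 1 | |(y : ℝ) - (ratPairOf m).1| < (ratPairOf m).2} n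

/-- A code of the pair `(3, 1)`, which describes a ball disjoint from `[0,1]`. -/
def codeFar : ℕ := Nat.pair (Nat.pair (Nat.pair 3 0) 0) (Nat.pair (Nat.pair 1 0) 0)

theorem ratPairOf_codeFar : ratPairOf codeFar = (3, 1) := by
  simp [codeFar, ratPairOf, ratOf]

open Classical in
/-- An enumeration of the codes of all balls on which `f` oscillates by at most `2⁻ⁿ`; the remaining
positions are filled with a ball disjoint from `[0,1]`. -/
noncomputable def smallBall (f : Icc (0 : ℝ) 1 → ℝ) (n i : ℕ) : ℕ :=
  if IsSmallBall f n i then i else codeFar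

theorem smallBall_pos (f : Icc (0 : ℝ) 1 → ℝ) (n i : ℕ) : 0 < (ratPairOf (smallBall f n i)).2 := by
  unfold smallBall
  split_ifs with h
  · exact h.1
  · simp [ratPairOf_codeFar]

theorem contSet_eq_iInter_smallBall (f : Icc (0 : ℝ) 1 → ℝ) : contSet f =
    ⋂ n, ⋃ i, {x : Icc (0 : ℝ) 1 | (x : ℝ) ∈ Metric.ball ((ratPairOf (smallBall f n i)).1 : ℝ)
      ((ratPairOf (smallBall f n i)).2 : ℝ)} := by
  ext x
  simp only [mem_iInter, mem_iUnion, mem_ofPred_eq, Metric.mem_ball, Real.dist_eq]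
  constructor
  · intro hx n
    obtain ⟨k, hk⟩ := exists_ball_smallOsc hx n
    obtain ⟨r, hr₁, hr₂⟩ := exists_rat_btwn (show (0 : ℝ) < 1 / 2 ^ k / 2 by positivity)
    obtain ⟨c, hc₁, hc₂⟩ := exists_rat_btwn (show (x : ℝ) < x + r by linarith)
    obtain ⟨i, hi⟩ := exists_ratPairOf (c, r)
    have hball : IsSmallBall f n i := by
      rw [IsSmallBall, hi]
      refine ⟨by exact_mod_cast hr₁, fun y hy z hz => hk y ?_ z ?_⟩
      · rw [Metric.mem_ball, Subtype.dist_eq, Real.dist_eq]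
        have := abs_lt.1 (show |(y : ℝ) - c| < r from hy)
        exact abs_lt.2 ⟨by linarith, by linarith⟩
      · rw [Metric.mem_ball, Subtype.dist_eq, Real.dist_eq]
        have := abs_lt.1 (show |(z : ℝ) - c| < r from hz)
        exact abs_lt.2 ⟨by linarith, by linarith⟩
    refine ⟨i, ?_⟩
    rw [smallBall, if_pos hball, hi]
    exact abs_lt.2 ⟨by linarith, by linarith⟩
  · refine fun h => mem_contSet_of_smallOsc fun n => ?_
    obtain ⟨i, hi⟩ := h n
    by_cases hball : IsSmallBall f n i
    · rw [smallBall, if_pos hball] at hi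
      exact ⟨_, isOpen_rat_ball i, hi, hball.2⟩
    · rw [smallBall, if_neg hball, ratPairOf_codeFar] at hi
      have := (abs_lt.1 hi).1
      norm_num at this
      linarith [x.2.2]

/-! ### Moduli of continuity and of quasi-continuity -/

/-- The least modulus of continuity at `x`, with the non-strict bound `2⁻ᵏ⁻¹`, which can be tested
at rational points; the value is `0` at some points of discontinuity. -/
noncomputable def contModulus (f : Icc (0 : ℝ) 1 → ℝ) (x : Icc (0 : ℝ) 1) (k : ℕ) : ℕ :=
  sInf {m | ∀ y ∈ Metric.ball x (1 / 2 ^ m), |f x - f y| ≤ 1 / 2 ^ (k + 1)}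

theorem one_div_two_pow_succ_lt (k : ℕ) : (1 : ℝ) / 2 ^ (k + 1) < 1 / 2 ^ k :=
  one_div_pow_lt_one_div_pow_of_lt one_lt_two k.lt_succ_self

theorem isModulusCont_contModulus (f : Icc (0 : ℝ) 1 → ℝ) : IsModulusCont f (contModulus f) := by
  intro k x hx y hy
  have hne : {m : ℕ | ∀ y ∈ Metric.ball x (1 / 2 ^ m), |f x - f y| ≤ 1 / 2 ^ (k + 1)}.Nonempty := by
    obtain ⟨m, hm⟩ := exists_ball_smallOsc hx (k + 1)
    exact ⟨m, hm x (Metric.mem_ball_self (by positivity))⟩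
  refine (Nat.sInf_mem hne y ?_).trans_lt (one_div_two_pow_succ_lt k)
  rwa [Metric.mem_ball, dist_comm, Subtype.dist_eq, Real.dist_eq]

/-- `m` codes an interval as required of a modulus of quasi-continuity. -/
def IsNearInterval (f : Icc (0 : ℝ) 1 → ℝ) (x : Icc (0 : ℝ) 1) (k N m : ℕ) : Prop :=
  (((ratPairOf m).1 : ℝ) < (ratPairOf m).2 ∧ (0 : ℝ) ≤ (ratPairOf m).1 ∧
    ((ratPairOf m).2 : ℝ) ≤ 1 ∧ (x : ℝ) - 1 / 2 ^ N ≤ (ratPairOf m).1 ∧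
    ((ratPairOf m).2 : ℝ) ≤ x + 1 / 2 ^ N) ∧ ∀ y ∈ unitIoo m, |f x - f y| ≤ 1 / 2 ^ (k + 1)

/-- The least code of an interval as required of a modulus of quasi-continuity. -/
noncomputable def nearInterval (f : Icc (0 : ℝ) 1 → ℝ) (x : Icc (0 : ℝ) 1) (k N : ℕ) : ℕ :=
  sInf {m | IsNearInterval f x k N m}

theorem QuasiContinuous.exists_isNearInterval {f : Icc (0 : ℝ) 1 → ℝ} (hf : QuasiContinuous f)
    (x : Icc (0 : ℝ) 1) (k N : ℕ) : ∃ m, IsNearInterval f x k N m := by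
  obtain ⟨G, hG, hne, hGU, h⟩ := hf x (1 / 2 ^ (k + 1)) (by positivity)
    (Metric.ball x (1 / 2 ^ N)) Metric.isOpen_ball (Metric.mem_ball_self (by positivity))
  obtain ⟨m, hm, hsub⟩ := exists_rat_Icc_subset hG hne
  have hm' : ((ratPairOf m).1 : ℝ) < (ratPairOf m).2 := Rat.cast_lt.2 hm
  obtain ⟨hl, hlG⟩ := hsub _ le_rfl hm'.le
  obtain ⟨hr, hrG⟩ := hsub _ hm'.le le_rfl
  have h₁ := hGU hlG
  have h₂ := hGU hrG
  rw [Metric.mem_ball, Subtype.dist_eq, Real.dist_eq, abs_lt] at h₁ h₂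
  refine ⟨m, ⟨hm', hl.1, hr.2, by linarith, by linarith⟩, fun y hy => ?_⟩
  obtain ⟨_, hy'⟩ := hsub y hy.1.le hy.2.le
  exact (h _ hy').le

theorem QuasiContinuous.isModulusQuasiCont {f : Icc (0 : ℝ) 1 → ℝ} (hf : QuasiContinuous f) :
    IsModulusQuasiCont f fun x k N => ratPairOf (nearInterval f x k N) := by
  intro x k N
  obtain ⟨⟨h₁, h₂, h₃, h₄, h₅⟩, h₆⟩ :=
    Nat.sInf_mem (s := {m | IsNearInterval f x k N m}) (hf.exists_isNearInterval x k N)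
  refine ⟨Rat.cast_lt.1 h₁, fun y hy => ?_, fun y hy =>
    (h₆ y hy).trans_lt (one_div_two_pow_succ_lt k)⟩
  have hy₁ := h₂.trans_lt hy.1
  have hy₂ := hy.2.trans_le h₃
  refine ⟨⟨hy₁.le, hy₂.le⟩, ?_⟩
  rw [Metric.mem_ball, Real.dist_eq, abs_lt]
  have hy₃ := h₄.trans_lt hy.1
  have hy₄ := hy.2.trans_le h₅
  constructor <;> linarith

/-! ### Oscillation -/

theorem oscOn_mono (f : Icc (0 : ℝ) 1 → ℝ) {U V : Set (Icc (0 : ℝ) 1)} (h : U ⊆ V) :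
    oscOn f U ≤ oscOn f V :=
  EReal.sub_le_sub (biSup_mono h) (biInf_mono h)

/-- The oscillations on shrinking balls decrease, so that their limit is their infimum. -/
theorem isOscAt_iInf (f : Icc (0 : ℝ) 1 → ℝ) (x : Icc (0 : ℝ) 1) :
    IsOscAt f x (⨅ k : ℕ, oscOn f (Metric.ball x (1 / 2 ^ k))) :=
  tendsto_atTop_iInf fun _ _ h => oscOn_mono f <| Metric.ball_subset_ball <|
    one_div_pow_le_one_div_pow_of_le one_le_two h

theorem le_oscOn {f : Icc (0 : ℝ) 1 → ℝ} {U : Set (Icc (0 : ℝ) 1)} {y z : Icc (0 : ℝ) 1}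
    (hy : y ∈ U) (hz : z ∈ U) : ((f y - f z : ℝ) : EReal) ≤ oscOn f U := by
  rw [EReal.coe_sub]
  exact EReal.sub_le_sub (le_biSup (fun y => (f y : EReal)) hy)
    (biInf_le (fun y => (f y : EReal)) hz)

theorem oscOn_le {f : Icc (0 : ℝ) 1 → ℝ} {U : Set (Icc (0 : ℝ) 1)} (hU : U.Nonempty) {r : ℝ}
    (h : ∀ y ∈ U, ∀ z ∈ U, f y - f z ≤ r) : oscOn f U ≤ r := by
  obtain ⟨x, hx⟩ := hU
  have htop : (⨆ y ∈ U, (f y : EReal)) ≤ ((f x + r : ℝ) : EReal) :=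
    iSup₂_le fun y hy => EReal.coe_le_coe_iff.2 (by linarith [h y hy x hx])
  have hbot : (f x : EReal) ≤ ⨆ y ∈ U, (f y : EReal) := le_biSup (fun y => (f y : EReal)) hx
  obtain ⟨s, hs⟩ : ∃ s : ℝ, (s : EReal) = ⨆ y ∈ U, (f y : EReal) :=
    ⟨_, EReal.coe_toReal (htop.trans_lt (EReal.coe_lt_top _)).ne
      ((EReal.bot_lt_coe _).trans_le hbot).ne'⟩
  have hinf : ((s - r : ℝ) : EReal) ≤ ⨅ y ∈ U, (f y : EReal) := by
    refine le_iInf₂ fun z hz => EReal.coe_le_coe_iff.2 ?_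
    have : (s : EReal) ≤ ((f z + r : ℝ) : EReal) := by
      rw [hs]
      exact iSup₂_le fun y hy => EReal.coe_le_coe_iff.2 (by linarith [h y hy z hz])
    linarith [EReal.coe_le_coe_iff.1 this]
  rw [oscOn, ← hs]
  refine (EReal.sub_le_sub le_rfl hinf).trans ?_
  rw [← EReal.coe_sub]
  exact EReal.coe_le_coe_iff.2 (by linarith)

theorem QuasiContinuous.lt_oscOn_iff {f : Icc (0 : ℝ) 1 → ℝ} (hf : QuasiContinuous f)
    {U : Set (Icc (0 : ℝ) 1)} (hU : IsOpen U) (hne : U.Nonempty) (r : ℝ) :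
    (r : EReal) < oscOn f U ↔ ∃ i j, unitPoint i ∈ U ∧ unitPoint j ∈ U ∧
      r < f (unitPoint i) - f (unitPoint j) := by
  constructor
  · intro h
    by_contra! hcon
    refine h.not_ge (oscOn_le hne fun y hy z hz => ?_)
    have h₁ : ∀ i, unitPoint i ∈ U → f (unitPoint i) - f z ≤ r := fun i hi =>
      hf.mem_of_unitPoint (K := {v | f (unitPoint i) - v ≤ r}) hU
        (isClosed_le (by fun_prop) continuous_const) (fun j hj => hcon i j hi hj) hz
    exact hf.mem_of_unitPoint (K := {v | v - f z ≤ r}) hU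
      (isClosed_le (by fun_prop) continuous_const) h₁ hy
  · rintro ⟨i, j, hi, hj, h⟩
    exact (EReal.coe_lt_coe_iff.2 h).trans_le (le_oscOn hi hj)

theorem oscillation_ne_bot (f : Icc (0 : ℝ) 1 → ℝ) (x : Icc (0 : ℝ) 1) :
    (⨅ k : ℕ, oscOn f (Metric.ball x (1 / 2 ^ k))) ≠ ⊥ := by
  refine ((EReal.bot_lt_coe 0).trans_le (le_iInf fun k => ?_)).ne'
  have hx : x ∈ Metric.ball x (1 / 2 ^ k) := Metric.mem_ball_self (by positivity)
  simpa using le_oscOn (f := f) hx hx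

/-! ### Finite coverings -/

/-- Already the balls around rational points cover `[0,1]`, and by compactness finitely many
slightly smaller ones do. -/
theorem QuasiContinuous.exists_finite_cover {Ψ : Icc (0 : ℝ) 1 → ℝ} (hΨ : QuasiContinuous Ψ)
    (hpos : ∀ x, 0 < Ψ x) : ∃ N : ℕ, ∀ y : Icc (0 : ℝ) 1, ∃ i ≤ N,
      |(y : ℝ) - unitPoint i| + 1 / 2 ^ N < Ψ (unitPoint i) := by
  let U : ℕ → Set (Icc (0 : ℝ) 1) := fun N =>
    ⋃ i ≤ N, {y | |(y : ℝ) - unitPoint i| + 1 / 2 ^ N < Ψ (unitPoint i)}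
  have hU : ∀ N, IsOpen (U N) := fun N => isOpen_biUnion fun i _ =>
    isOpen_lt (by fun_prop) continuous_const
  have hmono : Monotone U := by
    intro N M hNM y hy
    simp only [U, mem_iUnion, mem_ofPred_eq, exists_prop] at hy ⊢
    obtain ⟨i, hi, h⟩ := hy
    have : (1 : ℝ) / 2 ^ M ≤ 1 / 2 ^ N := one_div_pow_le_one_div_pow_of_le one_le_two hNM
    exact ⟨i, hi.trans hNM, by linarith⟩
  have hcov : (univ : Set (Icc (0 : ℝ) 1)) ⊆ ⋃ N, U N := by
    intro y _
    obtain ⟨i, hi, h⟩ := hΨ.exists_unitPoint (U := Metric.ball y (Ψ y / 4)) Metric.isOpen_ball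
      (Metric.mem_ball_self (by linarith [hpos y])) (show 0 < Ψ y / 4 by linarith [hpos y])
    rw [Metric.mem_ball, dist_comm, Subtype.dist_eq, Real.dist_eq] at hi
    obtain ⟨n, hn⟩ := one_div_two_pow_lt (show 0 < Ψ y / 4 by linarith [hpos y])
    have : (1 : ℝ) / 2 ^ max n i ≤ 1 / 2 ^ n :=
      one_div_pow_le_one_div_pow_of_le one_le_two (le_max_left _ _)
    simp only [U, mem_iUnion, mem_ofPred_eq, exists_prop]
    exact ⟨max n i, i, le_max_right _ _, by linarith [(abs_lt.1 h).2, hpos y]⟩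
  obtain ⟨N, hN⟩ := isCompact_univ.elim_directed_cover U hU hcov hmono.directed_le
  refine ⟨N, fun y => ?_⟩
  simpa [U] using hN (mem_univ y)

/-- A margin that is uniform over the rational points suffices for a covering. -/
theorem exists_mem_ball_of_unitPoint {Ψ : Icc (0 : ℝ) 1 → ℝ} {N : ℕ}
    (h : ∀ j, ∃ i ≤ N, |(unitPoint j : ℝ) - unitPoint i| + 1 / 2 ^ N < Ψ (unitPoint i))
    (y : Icc (0 : ℝ) 1) : ∃ i ≤ N, y ∈ Metric.ball (unitPoint i) (Ψ (unitPoint i)) := by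
  obtain ⟨j, hj⟩ := denseRange_unitPoint.exists_dist_lt y (show (0 : ℝ) < 1 / 2 ^ N by positivity)
  obtain ⟨i, hi, hlt⟩ := h j
  refine ⟨i, hi, ?_⟩
  rw [← Real.dist_eq, ← Subtype.dist_eq] at hlt
  rw [Metric.mem_ball]
  linarith [dist_triangle y (unitPoint j) (unitPoint i)]

/-- The least `N` such that the balls of radius `Ψ (unitPoint i)`, shrunk by `2⁻ᴺ`, around the
points `unitPoint i` with `i ≤ N` cover the rational points of `[0,1]`. -/
noncomputable def coverBound (Ψ : Icc (0 : ℝ) 1 → ℝ) : ℕ :=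
  sInf {N | ∀ j, ∃ i, i ≤ N ∧ |(unitPoint j : ℝ) - unitPoint i| + 1 / 2 ^ N < Ψ (unitPoint i)}

theorem QuasiContinuous.exists_mem_ball_of_le_coverBound {Ψ : Icc (0 : ℝ) 1 → ℝ}
    (hΨ : QuasiContinuous Ψ) (hpos : ∀ x, 0 < Ψ x) (y : Icc (0 : ℝ) 1) :
    ∃ i ≤ coverBound Ψ, y ∈ Metric.ball (unitPoint i) (Ψ (unitPoint i)) := by
  obtain ⟨N, hN⟩ := hΨ.exists_finite_cover hpos
  exact exists_mem_ball_of_unitPoint (Nat.sInf_mem (s := {N | ∀ j, ∃ i, i ≤ N ∧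
    |(unitPoint j : ℝ) - unitPoint i| + 1 / 2 ^ N < Ψ (unitPoint i)}) ⟨N, fun j => hN _⟩) y

/-! ### Riemann sums -/

/-- `s` is a Riemann sum of `f` over a tagged partition of `[a,b]` of mesh below `δ`. -/
inductive IsRiemannSum (f : Icc (0 : ℝ) 1 → ℝ) (δ : ℝ) (a : Icc (0 : ℝ) 1) :
    Icc (0 : ℝ) 1 → ℝ → Prop
  | nil : IsRiemannSum f δ a a 0
  | snoc {b c ξ : Icc (0 : ℝ) 1} {s : ℝ} : IsRiemannSum f δ a b s → b ≤ ξ → ξ ≤ c →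
      (c : ℝ) - b < δ → IsRiemannSum f δ a c (s + f ξ * ((c : ℝ) - b))

theorem IsRiemannSum.append {f : Icc (0 : ℝ) 1 → ℝ} {δ : ℝ} {a b c : Icc (0 : ℝ) 1} {s t : ℝ}
    (hs : IsRiemannSum f δ a b s) (ht : IsRiemannSum f δ b c t) :
    IsRiemannSum f δ a c (s + t) := by
  induction ht with
  | nil => simpa using hs
  | snoc _ h₁ h₂ h₃ ih =>
    rw [← add_assoc]
    exact ih.snoc h₁ h₂ h₃

theorem IsRiemannSum.exists_partition {f : Icc (0 : ℝ) 1 → ℝ} {δ : ℝ} {a b : Icc (0 : ℝ) 1}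
    {s : ℝ} (h : IsRiemannSum f δ a b s) : ∃ (n : ℕ) (t ξ : ℕ → Icc (0 : ℝ) 1), t 0 = a ∧ t n = b ∧
      (∀ i < n, t i ≤ ξ i ∧ ξ i ≤ t (i + 1) ∧ (t (i + 1) : ℝ) - t i < δ) ∧
      ∑ i ∈ Finset.range n, f (ξ i) * ((t (i + 1) : ℝ) - t i) = s := by
  induction h with
  | nil => exact ⟨0, fun _ => a, fun _ => a, by simp⟩
  | @snoc b c ξ s _ h₁ h₂ h₃ ih =>
    obtain ⟨n, t, ξ', h0, hn, ht, hs⟩ := ih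
    refine ⟨n + 1, fun i => if i ≤ n then t i else c, fun i => if i < n then ξ' i else ξ,
      by simpa using h0, by simp, fun i hi => ?_, ?_⟩
    · rcases (Nat.lt_succ_iff.1 hi).lt_or_eq with h | rfl
      · simpa [h, h.le, Nat.succ_le_of_lt h] using ht i h
      · simpa [hn] using ⟨h₁, h₂, h₃⟩
    · rw [Finset.sum_range_succ, ← hs]
      congr 1
      · refine Finset.sum_congr rfl fun i hi => ?_
        have h := Finset.mem_range.1 hi
        simp [h, h.le, Nat.succ_le_of_lt h]
      · simp [hn]

theorem HasRiemannIntegral.exists_mesh {f : Icc (0 : ℝ) 1 → ℝ} {a b : Icc (0 : ℝ) 1} {J : ℝ}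
    (h : HasRiemannIntegral f a b J) {ε : ℝ} (hε : 0 < ε) :
    ∃ δ > 0, ∀ δ' ≤ δ, ∀ s, IsRiemannSum f δ' a b s → |s - J| < ε := by
  obtain ⟨δ, hδ, hs⟩ := h ε hε
  refine ⟨δ, hδ, fun δ' hle s h => ?_⟩
  obtain ⟨n, t, ξ, h0, hn, ht, rfl⟩ := h.exists_partition
  exact hs n t ξ h0 hn fun i hi => ⟨(ht i hi).1, (ht i hi).2.1, (ht i hi).2.2.trans_le hle⟩

/-- There are Riemann sums of arbitrarily small mesh, and they obey the bounds of `f`. -/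
theorem exists_isRiemannSum (f : Icc (0 : ℝ) 1 → ℝ) {δ : ℝ} (hδ : 0 < δ) {a b : Icc (0 : ℝ) 1}
    (hab : a ≤ b) : ∃ s, IsRiemannSum f δ a b s ∧
      (∀ c : ℝ, (∀ y ∈ Icc a b, c ≤ f y) → c * ((b : ℝ) - a) ≤ s) ∧
      ∀ d : ℝ, (∀ y ∈ Icc a b, f y ≤ d) → s ≤ d * ((b : ℝ) - a) := by
  obtain ⟨n, hn⟩ := exists_nat_ge (((b : ℝ) - a) / (δ / 2))
  rw [div_le_iff₀ (by positivity)] at hn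
  induction n generalizing b with
  | zero =>
    have : (b : ℝ) ≤ a := by simpa using hn
    obtain rfl : a = b := le_antisymm hab this
    exact ⟨0, .nil, by simp⟩
  | succ n ih =>
    -- The last piece of the partition is `[b', b]`.
    let b' : Icc (0 : ℝ) 1 := ⟨max (a : ℝ) (b - δ / 2), a.2.1.trans (le_max_left _ _),
      max_le a.2.2 (by linarith [b.2.2])⟩
    have hab' : a ≤ b' := le_max_left (a : ℝ) _
    have hb'b : b' ≤ b := max_le (α := ℝ) hab (by linarith)
    have hlen : (b : ℝ) - b' < δ := by
      have : (b : ℝ) - δ / 2 ≤ b' := le_max_right _ _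
      linarith
    obtain ⟨s, hs, hbd⟩ := ih hab' (by
      push_cast at hn
      rcases max_choice (a : ℝ) (b - δ / 2) with h | h
      · have : (b' : ℝ) = a := h
        rw [this]
        have : (0 : ℝ) ≤ n * (δ / 2) := by positivity
        linarith
      · have : (b' : ℝ) = b - δ / 2 := h
        rw [this]
        linarith)
    have h₀ : (0 : ℝ) ≤ (b : ℝ) - b' := sub_nonneg.2 hb'b
    refine ⟨_, hs.snoc hb'b le_rfl hlen, fun c hc => ?_, fun d hd => ?_⟩
    · have h₁ := hbd.1 c fun y hy => hc y ⟨hy.1, hy.2.trans hb'b⟩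
      have h₂ := mul_le_mul_of_nonneg_right (hc b ⟨hab, le_rfl⟩) h₀
      linarith
    · have h₁ := hbd.2 d fun y hy => hd y ⟨hy.1, hy.2.trans hb'b⟩
      have h₂ := mul_le_mul_of_nonneg_right (hd b ⟨hab, le_rfl⟩) h₀
      linarith

/-- Bounds of `f` on `[u,v]` are bounds for the difference of the integrals up to `v` and `u`.  The
integral over `[u,v]` itself is not needed: a Riemann sum for `[0,u]` is continued to one for
`[0,v]`. -/
theorem HasRiemannIntegral.sub_mem {f : Icc (0 : ℝ) 1 → ℝ} {u v : Icc (0 : ℝ) 1} (huv : u ≤ v)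
    {I J : ℝ} (hu : HasRiemannIntegral f 0 u I) (hv : HasRiemannIntegral f 0 v J) {c d : ℝ}
    (h : ∀ y ∈ Icc u v, c ≤ f y ∧ f y ≤ d) :
    c * ((v : ℝ) - u) ≤ J - I ∧ J - I ≤ d * ((v : ℝ) - u) := by
  have key : ∀ ε > 0, c * ((v : ℝ) - u) ≤ J - I + ε ∧ J - I ≤ d * ((v : ℝ) - u) + ε := by
    intro ε hε
    obtain ⟨δ₁, hδ₁, h₁⟩ := hu.exists_mesh (half_pos hε)
    obtain ⟨δ₂, hδ₂, h₂⟩ := hv.exists_mesh (half_pos hε)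
    obtain ⟨s, hs, -⟩ := exists_isRiemannSum f (lt_min hδ₁ hδ₂) (show 0 ≤ u from u.2.1)
    obtain ⟨t, ht, hbd⟩ := exists_isRiemannSum f (lt_min hδ₁ hδ₂) huv
    have h₃ := abs_lt.1 (h₁ _ (min_le_left _ _) s hs)
    have h₄ := abs_lt.1 (h₂ _ (min_le_right _ _) _ (hs.append ht))
    have h₅ := hbd.1 c fun y hy => (h y hy).1
    have h₆ := hbd.2 d fun y hy => (h y hy).2
    constructor <;> linarith
  exact ⟨le_of_forall_pos_le_add fun ε hε => (key ε hε).1,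
    le_of_forall_pos_le_add fun ε hε => (key ε hε).2⟩

/-- A positive value at a continuity point would keep the Riemann sums away from `0`. -/
theorem HasRiemannIntegral.eq_zero_of_continuousAt {f : Icc (0 : ℝ) 1 → ℝ} (h₀ : ∀ x, 0 ≤ f x)
    (h : HasRiemannIntegral f 0 1 0) {x : Icc (0 : ℝ) 1} (hx : x ∈ contSet f) : f x = 0 := by
  by_contra hne
  have hpos : 0 < f x := lt_of_le_of_ne (h₀ x) (Ne.symm hne)
  have hx' : ContinuousAt f x := hx
  obtain ⟨U, hUsub, hU, hxU⟩ := mem_nhds_iff.1 (hx'.eventually (lt_mem_nhds (half_lt_self hpos)))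
  obtain ⟨m, hm, hsub⟩ := exists_rat_Icc_subset hU ⟨x, hxU⟩
  have hm' : ((ratPairOf m).1 : ℝ) < (ratPairOf m).2 := by exact_mod_cast hm
  obtain ⟨hu, -⟩ := hsub _ le_rfl hm'.le
  obtain ⟨hv, -⟩ := hsub _ hm'.le le_rfl
  set u : Icc (0 : ℝ) 1 := ⟨_, hu⟩
  set v : Icc (0 : ℝ) 1 := ⟨_, hv⟩
  have hεpos : 0 < f x / 2 * ((v : ℝ) - u) := mul_pos (half_pos hpos) (sub_pos.2 hm')
  obtain ⟨δ, hδ, hs⟩ := h.exists_mesh hεpos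
  obtain ⟨s₁, hs₁, h₁, -⟩ := exists_isRiemannSum f hδ (show 0 ≤ u from u.2.1)
  obtain ⟨s₂, hs₂, h₂, -⟩ := exists_isRiemannSum f hδ (show u ≤ v from hm'.le)
  obtain ⟨s₃, hs₃, h₃, -⟩ := exists_isRiemannSum f hδ (show v ≤ 1 from v.2.2)
  have h₄ := h₁ 0 fun y _ => h₀ y
  have h₅ := h₂ (f x / 2) fun y hy => by
    obtain ⟨_, hy'⟩ := hsub y hy.1 hy.2
    exact (hUsub hy').le
  have h₆ := h₃ 0 fun y _ => h₀ y
  have := (abs_lt.1 (hs _ le_rfl _ ((hs₁.append hs₂).append hs₃))).2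
  linarith

/-- The fundamental theorem of calculus at a continuity point. -/
theorem hasDerivAt_of_hasRiemannIntegral {f : Icc (0 : ℝ) 1 → ℝ} {F : ℝ → ℝ}
    (hF : ∀ x : Icc (0 : ℝ) 1, HasRiemannIntegral f 0 x (F x)) {x : Icc (0 : ℝ) 1}
    (hx₀ : 0 < (x : ℝ)) (hx₁ : (x : ℝ) < 1) (hx : x ∈ contSet f) : HasDerivAt F (f x) (x : ℝ) := by
  rw [hasDerivAt_iff_isLittleO, Asymptotics.isLittleO_iff]
  intro ε hε
  obtain ⟨δ, hδ, h⟩ := Metric.tendsto_nhds_nhds.1 hx ε hε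
  filter_upwards [Metric.ball_mem_nhds (x : ℝ) hδ, Ioo_mem_nhds hx₀ hx₁] with y hy hy'
  rw [Metric.mem_ball, Real.dist_eq] at hy
  have bound {u v : Icc (0 : ℝ) 1} (hxu : |(u : ℝ) - x| < δ) (hxv : |(v : ℝ) - x| < δ) (z)
      (hz : z ∈ Icc u v) : f x - ε ≤ f z ∧ f z ≤ f x + ε := by
    have h₁ : (u : ℝ) ≤ z := hz.1
    have h₂ : (z : ℝ) ≤ v := hz.2
    have : dist z x < δ := by
      rw [Subtype.dist_eq, Real.dist_eq, abs_lt]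
      constructor <;> linarith [(abs_lt.1 hxu).1, (abs_lt.1 hxv).2]
    have := abs_lt.1 (h this)
    constructor <;> linarith
  have hxx : |(x : ℝ) - x| < δ := by simpa using hδ
  let w : Icc (0 : ℝ) 1 := ⟨y, hy'.1.le, hy'.2.le⟩
  have hw : (w : ℝ) = y := rfl
  rw [smul_eq_mul, Real.norm_eq_abs, Real.norm_eq_abs]
  rcases le_total x w with hle | hle
  · obtain ⟨h₁, h₂⟩ := (hF x).sub_mem hle (hF w) (bound hxx hy)
    rw [hw] at h₁ h₂
    have : 0 ≤ y - x := sub_nonneg.2 hle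
    rw [abs_of_nonneg this, abs_le]
    constructor <;> linarith
  · obtain ⟨h₁, h₂⟩ := (hF w).sub_mem hle (hF x) (bound hy hxx)
    rw [hw] at h₁ h₂
    have : y - x ≤ 0 := sub_nonpos.2 hle
    rw [abs_of_nonpos this, abs_le]
    constructor <;> linarith

/-! ### Decidability of the notions attached to a quasi-continuous function -/

namespace Setting

variable {ι : Type} {S : Setting ι} {X : Type} [Primcodable X]

theorem Cut.unitPoint {g : ι → X → ℕ} (hg : S.Comp g) :
    S.Cut fun c x => (unitPoint (g c x) : ℝ) :=
  ((Cut.rat 0).max ((Cut.rat 1).min (Cut.ofCode hg))).of_eq fun _ _ => by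
    simp [_root_.unitPoint, coe_projIcc]

theorem Cut.fst {g : ι → X → ℕ} (hg : S.Comp g) : S.Cut fun c x => ((ratPairOf (g c x)).1 : ℝ) :=
  Cut.ofCode (hg.map primrec_unpair_fst)

theorem Cut.snd {g : ι → X → ℕ} (hg : S.Comp g) : S.Cut fun c x => ((ratPairOf (g c x)).2 : ℝ) :=
  Cut.ofCode (hg.map primrec_unpair_snd)

theorem dec_mem_unitIoo {v : ι → X → Icc (0 : ℝ) 1} (hv : S.Cut fun c x => (v c x : ℝ))
    {g : ι → X → ℕ} (hg : S.Comp g) : S.Dec fun c x => v c x ∈ unitIoo (g c x) :=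
  ((Cut.fst hg).lt hv).and (hv.lt (Cut.snd hg))

theorem dec_mem_ball {u v : ι → X → Icc (0 : ℝ) 1} (hu : S.Cut fun c x => (u c x : ℝ))
    (hv : S.Cut fun c x => (v c x : ℝ)) {r : ι → X → ℝ} (hr : S.Cut r) :
    S.Dec fun c x => u c x ∈ Metric.ball (v c x) (r c x) :=
  (Cut.lt (hu.sub hv).abs hr).of_iff fun c x => by
    rw [Metric.mem_ball, Subtype.dist_eq, Real.dist_eq]

variable {f : ι → Icc (0 : ℝ) 1 → ℝ} (hq : ∀ c, QuasiContinuous (f c))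
  (hf : ∀ c, Represents (S.Φ c) (f c))

include hf in
theorem Cut.apply_unitPoint {g : ι → X → ℕ} (hg : S.Comp g) :
    S.Cut fun c x => f c (_root_.unitPoint (g c x)) :=
  Cut.apply hf (Cut.unitPoint hg)

include hq hf in
theorem dec_smallOsc {U : ι → X → Set (Icc (0 : ℝ) 1)} (hU : ∀ c x, IsOpen (U c x))
    (hd : S.Dec fun c (p : X × ℕ) => unitPoint p.2 ∈ U c p.1) {n : ι → X → ℕ} (hn : S.Comp n) :
    S.Dec fun c x => SmallOsc (f c) (U c x) (n c x) := by
  refine Dec.of_iff (P := fun c x => ∀ i j, unitPoint i ∈ U c x → unitPoint j ∈ U c x →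
    |f c (unitPoint i) - f c (unitPoint j)| ≤ 1 / 2 ^ n c x)
    (Dec.all (Dec.all (.imp ?_ (.imp ?_ ?_)))) fun c x => ((hq c).smallOsc_iff (hU c x) _).symm
  · exact hd.comp Comp.id.fst
  · exact Dec.comp (f := fun _ (p : (X × ℕ) × ℕ) => (p.1.1, p.2)) hd
      (Comp.id.fst.fst.pair Comp.id.snd)
  · exact Cut.le ((Cut.apply_unitPoint hf Comp.id.fst.snd).sub
      (Cut.apply_unitPoint hf Comp.id.snd)).abs (Cut.pow (hn.comp Comp.id.fst.fst))

include hq hf in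
theorem dec_forall_dist_le {U : ι → X → Set (Icc (0 : ℝ) 1)} (hU : ∀ c x, IsOpen (U c x))
    (hd : S.Dec fun c (p : X × ℕ) => unitPoint p.2 ∈ U c p.1) {a r : ι → X → ℝ} (ha : S.Cut a)
    (hr : S.Cut r) : S.Dec fun c x => ∀ y ∈ U c x, |a c x - f c y| ≤ r c x := by
  refine Dec.of_iff (P := fun c x => ∀ i, unitPoint i ∈ U c x →
    |a c x - f c (unitPoint i)| ≤ r c x) (Dec.all (.imp hd ?_)) fun c x =>
      ⟨fun h y hy => (hq c).dist_le_of_unitPoint (hU c x) h hy, fun h i hi => h _ hi⟩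
  exact Cut.le ((ha.comp Comp.id.fst).sub (Cut.apply_unitPoint hf Comp.id.snd)).abs
    (hr.comp Comp.id.fst)

include hq hf in
theorem dec_smallOsc_ball {v : ι → X → Icc (0 : ℝ) 1} (hv : S.Cut fun c x => (v c x : ℝ))
    {k n : ι → X → ℕ} (hk : S.Comp k) (hn : S.Comp n) :
    S.Dec fun c x => SmallOsc (f c) (Metric.ball (v c x) (1 / 2 ^ k c x)) (n c x) :=
  dec_smallOsc hq hf (U := fun c x => Metric.ball (v c x) (1 / 2 ^ k c x))
    (fun _ _ => Metric.isOpen_ball) (dec_mem_ball (Cut.unitPoint Comp.id.snd) (hv.comp Comp.id.fst)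
      (Cut.pow (hk.comp Comp.id.fst))) hn

include hq hf in
theorem dec_mem_contSet {v : ι → X → Icc (0 : ℝ) 1} (hv : S.Cut fun c x => (v c x : ℝ)) :
    S.Dec fun c x => v c x ∈ contSet (f c) :=
  (Dec.all (P := fun c x n => ∃ k : ℕ, SmallOsc (f c) (Metric.ball (v c x) (1 / 2 ^ k)) n)
    (Dec.ex (dec_smallOsc_ball hq hf (hv.comp Comp.id.fst.fst) Comp.id.snd
      Comp.id.fst.snd))).of_iff fun _ _ => mem_contSet_iff.symm

include hq hf in
theorem dec_shrinks {n l m : ι → X → ℕ} (hn : S.Comp n) (hl : S.Comp l) (hm : S.Comp m) :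
    S.Dec fun c x => Shrinks (f c) (n c x) (l c x) (m c x) := by
  have h := ((Cut.fst hl).lt (Cut.fst hm)).and <| ((Cut.fst hm).lt (Cut.snd hm)).and <|
    ((Cut.snd hm).lt (Cut.snd hl)).and <| dec_smallOsc hq hf (fun c x => isOpen_unitIoo (m c x))
      (dec_mem_unitIoo (Cut.unitPoint Comp.id.snd) (hm.comp Comp.id.fst)) hn
  refine h.of_iff fun c x => ?_
  simp only [Shrinks, Rat.cast_lt]

include hq hf in
theorem comp_nested : S.Comp fun c n => nested (f c) n :=
  Comp.natRec (step := fun c n l => sInf {m | Shrinks (f c) n l m}) <|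
    Comp.least (dec_shrinks hq hf Comp.id.fst.fst Comp.id.fst.snd Comp.id.snd)

include hq hf in
theorem cut_contPoint : S.Cut fun c (_ : X) => contPoint (f c) := by
  refine Dec.of_iff (P := fun c (p : X × ℕ) =>
      ∃ n, (ratOf p.2 : ℝ) < (ratPairOf (nested (f c) n)).1)
    (Dec.ex (Cut.lt (Cut.ofCode Comp.id.fst.snd)
      (Cut.fst ((comp_nested hq hf).comp Comp.id.snd)))) fun c p => ?_
  constructor
  · rintro ⟨n, hn⟩
    exact hn.trans ((hq c).contPoint_spec n).1
  · exact exists_lt_of_lt_ciSup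

include hq hf in
theorem ecut_oscillation {v : ι → X → Icc (0 : ℝ) 1} (hv : S.Cut fun c x => (v c x : ℝ)) :
    S.ECut fun c x => ⨅ k : ℕ, oscOn (f c) (Metric.ball (v c x) (1 / 2 ^ k)) := by
  have hball {Y : Type} [Primcodable Y] {i k : ι → Y → ℕ} {y : ι → Y → X} (hi : S.Comp i)
      (hk : S.Comp k) (hy : S.Comp y) :
      S.Dec fun c z => unitPoint (i c z) ∈ Metric.ball (v c (y c z)) (1 / 2 ^ k c z) :=
    dec_mem_ball (Cut.unitPoint hi) (hv.comp hy) (Cut.pow hk)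
  refine Dec.of_iff (P := fun c (p : X × ℕ) => ∃ r, ratOf p.2 < ratOf r ∧ ∀ k : ℕ, ∃ i j,
      unitPoint i ∈ Metric.ball (v c p.1) (1 / 2 ^ k) ∧
      unitPoint j ∈ Metric.ball (v c p.1) (1 / 2 ^ k) ∧
      (ratOf r : ℝ) < f c (unitPoint i) - f c (unitPoint j))
    (Dec.ex (.and (Dec.rel primrec_ratOf_lt Comp.id.fst.snd Comp.id.snd)
      (Dec.all (Dec.ex (Dec.ex (.and ?_ (.and ?_ ?_))))))) fun c p => ?_
  · exact hball Comp.id.fst.snd Comp.id.fst.fst.snd Comp.id.fst.fst.fst.fst.fst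
  · exact hball Comp.id.snd Comp.id.fst.fst.snd Comp.id.fst.fst.fst.fst.fst
  · exact (Cut.ofCode Comp.id.fst.fst.fst.snd).lt ((Cut.apply_unitPoint hf Comp.id.fst.snd).sub
      (Cut.apply_unitPoint hf Comp.id.snd))
  · have h (k : ℕ) (r : ℝ) := (hq c).lt_oscOn_iff (U := Metric.ball (v c p.1) (1 / 2 ^ k))
      Metric.isOpen_ball ⟨_, Metric.mem_ball_self (by positivity)⟩ r
    simp only [← h]
    constructor
    · rintro ⟨r, hr, hk⟩
      exact (EReal.coe_lt_coe_iff.2 (Rat.cast_lt.2 hr)).trans_le (le_iInf fun k => (hk k).le)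
    · intro hlt
      obtain ⟨s, hs₁, hs₂⟩ := EReal.lt_iff_exists_real_btwn.1 hlt
      obtain ⟨r, hr₁, hr₂⟩ := exists_ratOf_btwn (EReal.coe_lt_coe_iff.1 hs₁)
      refine ⟨r, Rat.cast_lt.1 hr₁, fun k => ?_⟩
      exact ((EReal.coe_lt_coe_iff.2 hr₂).trans hs₂).trans_le (iInf_le _ k)

/-- The supremum of `f` over `[p,q]`, with the value at `p` thrown in to make it greater than `-∞`
for all `p` and `q`. -/
noncomputable def _root_.ratSup (f : Icc (0 : ℝ) 1 → ℝ) (p q : ℕ) : EReal :=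
  max (f (unitPoint p) : EReal)
    (⨆ (x : Icc (0 : ℝ) 1) (_ : (ratOf p : ℝ) ≤ x ∧ (x : ℝ) ≤ ratOf q), (f x : EReal))

theorem _root_.ratSup_eq (f : Icc (0 : ℝ) 1 → ℝ) {p q : ℕ} (h₀ : 0 ≤ ratOf p)
    (hpq : ratOf p ≤ ratOf q) (h₁ : ratOf q ≤ 1) : ratSup f p q =
      ⨆ (x : Icc (0 : ℝ) 1) (_ : (ratOf p : ℝ) ≤ x ∧ (x : ℝ) ≤ ratOf q), (f x : EReal) := by
  refine max_eq_right (le_iSup₂_of_le (unitPoint p) ?_ le_rfl)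
  rw [unitPoint_coe h₀ (hpq.trans h₁)]
  exact ⟨le_rfl, Rat.cast_le.2 hpq⟩

theorem _root_.QuasiContinuous.lt_ratSup_iff {f : Icc (0 : ℝ) 1 → ℝ} (hf : QuasiContinuous f)
    (p q : ℕ) (r : ℝ) : (r : EReal) < ratSup f p q ↔ r < f (unitPoint p) ∨
      ∃ i, (ratOf p : ℝ) ≤ unitPoint i ∧ (unitPoint i : ℝ) ≤ ratOf q ∧ r < f (unitPoint i) := by
  rw [ratSup, lt_max_iff, EReal.coe_lt_coe_iff]
  refine or_congr_right ?_
  simp only [lt_iSup_iff, EReal.coe_lt_coe_iff, exists_prop]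
  constructor
  · rintro ⟨x, ⟨hpx, hxq⟩, hx⟩
    -- The end points are rational, and interior points are approximated by rational ones.
    have endpoint {s : ℕ} (h : (ratOf s : ℝ) = x) : unitPoint s = x :=
      Subtype.ext <| (unitPoint_coe (by exact_mod_cast h ▸ x.2.1)
        (by exact_mod_cast h ▸ x.2.2)).trans h
    rcases hpx.eq_or_lt with h | hpx'
    · exact ⟨p, by rw [endpoint h]; exact ⟨hpx, hxq, hx⟩⟩
    rcases hxq.eq_or_lt with h | hxq'
    · exact ⟨q, by rw [endpoint h.symm]; exact ⟨hpx, hxq, hx⟩⟩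
    obtain ⟨i, hi, hlt⟩ := hf.exists_unitPoint (U := Subtype.val ⁻¹' Ioo (ratOf p : ℝ) (ratOf q))
      (isOpen_Ioo.preimage continuous_subtype_val) ⟨hpx', hxq'⟩ (sub_pos.2 hx)
    exact ⟨i, hi.1.le, hi.2.le, by linarith [(abs_lt.1 hlt).2]⟩
  · rintro ⟨i, h₁, h₂, h⟩
    exact ⟨_, ⟨h₁, h₂⟩, h⟩

include hq hf in
theorem ecut_ratSup : S.ECut fun c (x : ℕ × ℕ) => ratSup (f c) x.1 x.2 :=
  Dec.of_iff (.or (Cut.lt (Cut.ofCode Comp.id.snd) (Cut.apply_unitPoint hf Comp.id.fst.fst))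
    (Dec.ex (P := fun c (p : (ℕ × ℕ) × ℕ) i => (ratOf p.1.1 : ℝ) ≤ unitPoint i ∧
        (unitPoint i : ℝ) ≤ ratOf p.1.2 ∧ (ratOf p.2 : ℝ) < f c (unitPoint i))
      (.and (Cut.le (Cut.ofCode Comp.id.fst.fst.fst) (Cut.unitPoint Comp.id.snd))
        (.and (Cut.le (Cut.unitPoint Comp.id.snd) (Cut.ofCode Comp.id.fst.fst.snd))
          (Cut.lt (Cut.ofCode Comp.id.fst.snd) (Cut.apply_unitPoint hf Comp.id.snd))))))
    fun c _ => ((hq c).lt_ratSup_iff _ _ _).symm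

include hq hf in
theorem comp_smallBall : S.Comp fun c (p : ℕ × ℕ) => smallBall (f c) p.1 p.2 := by
  have hball : S.Dec fun c (p : ℕ × ℕ) => IsSmallBall (f c) p.1 p.2 := by
    have hpos := Cut.lt (S := S) (X := ℕ × ℕ) (Cut.rat 0) (Cut.snd Comp.id.snd)
    refine (hpos.and (dec_smallOsc hq hf (U := fun _ (p : ℕ × ℕ) =>
        {y : Icc (0 : ℝ) 1 | |(y : ℝ) - (ratPairOf p.2).1| < (ratPairOf p.2).2})
      (fun _ p => isOpen_rat_ball p.2) ?_ Comp.id.fst)).of_iff fun c p => by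
        rw [IsSmallBall, Rat.cast_lt]
    exact Cut.lt ((Cut.unitPoint Comp.id.snd).sub (Cut.fst Comp.id.fst.snd)).abs
      (Cut.snd Comp.id.fst.snd)
  exact Comp.ite hball Comp.id.snd (Comp.const codeFar)

include hq hf in
theorem comp_contModulus {x : ι → Icc (0 : ℝ) 1} (hx : S.Cut fun c (_ : Unit) => (x c : ℝ)) :
    S.Comp fun c k => contModulus (f c) (x c) k :=
  Comp.least (P := fun c k m => ∀ y ∈ Metric.ball (x c) (1 / 2 ^ m),
      |f c (x c) - f c y| ≤ 1 / 2 ^ (k + 1)) <|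
    dec_forall_dist_le hq hf (U := fun c (p : ℕ × ℕ) => Metric.ball (x c) (1 / 2 ^ p.2))
      (fun _ _ => Metric.isOpen_ball)
      (dec_mem_ball (Cut.unitPoint Comp.id.snd) (hx.comp (Comp.const ())) (Cut.pow Comp.id.fst.snd))
      ((Cut.apply hf hx).comp (Comp.const ())) (Cut.pow_succ Comp.id.fst)

include hq hf in
theorem comp_nearInterval {x : ι → Icc (0 : ℝ) 1} (hx : S.Cut fun c (_ : Unit) => (x c : ℝ)) :
    S.Comp fun c (p : ℕ × ℕ) => nearInterval (f c) (x c) p.1 p.2 := by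
  refine Comp.least (P := fun c (p : ℕ × ℕ) m => IsNearInterval (f c) (x c) p.1 p.2 m)
    (Dec.and ?_ ?_)
  · have hl := Cut.fst (S := S) (X := (ℕ × ℕ) × ℕ) Comp.id.snd
    have hr := Cut.snd (S := S) (X := (ℕ × ℕ) × ℕ) Comp.id.snd
    have hN := Cut.pow (S := S) (X := (ℕ × ℕ) × ℕ) Comp.id.fst.snd
    have hx' := hx.comp (X := (ℕ × ℕ) × ℕ) (Comp.const ())
    have h := (hl.lt hr).and <| ((Cut.rat 0).le hl).and <| (hr.le (Cut.rat 1)).and <|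
      ((hx'.sub hN).le hl).and (hr.le (hx'.add hN))
    exact h.of_iff fun c p => by simp only [Rat.cast_zero, Rat.cast_one]
  · exact dec_forall_dist_le hq hf (U := fun _ (p : (ℕ × ℕ) × ℕ) => unitIoo p.2)
      (fun _ p => isOpen_unitIoo p.2)
      (dec_mem_unitIoo (Cut.unitPoint Comp.id.snd) Comp.id.fst.snd)
      ((Cut.apply hf hx).comp (Comp.const ())) (Cut.pow_succ Comp.id.fst.fst)

include hf in
theorem comp_coverBound : S.Comp fun c (_ : X) => coverBound (f c) := by
  refine Comp.least (P := fun c (_ : X) N => ∀ j, ∃ i, i ≤ N ∧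
    |(unitPoint j : ℝ) - unitPoint i| + 1 / 2 ^ N < f c (unitPoint i))
    (Dec.all (Dec.ex (Dec.and (Dec.rel Primrec.nat_le Comp.id.snd Comp.id.fst.fst.snd) ?_)))
  exact Cut.lt (((Cut.unitPoint Comp.id.fst.snd).sub (Cut.unitPoint Comp.id.snd)).abs.add
    (Cut.pow Comp.id.fst.fst.snd)) (Cut.apply_unitPoint hf Comp.id.snd)

end Setting

/-! ### The computations -/

/-- A quasi-continuous function together with a representation. -/
structure QuasiRep where
  /-- The function. -/
  f : Icc (0 : ℝ) 1 → ℝ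
  /-- The representation. -/
  Φ : (ℕ → ℕ) → ℕ
  quasi : QuasiContinuous f
  rep : Represents Φ f

/-- A represented quasi-continuous function together with a name of a point of `[0,1]`. -/
structure PointedQuasiRep extends QuasiRep where
  /-- The point. -/
  x : Icc (0 : ℝ) 1
  /-- The name of the point. -/
  α : ℕ → ℕ
  names : Names α x

/-- The setting of computations from `∃²` and a representation. -/
def repSetting : Setting QuasiRep := ⟨QuasiRep.Φ, fun _ => [], 0, fun _ => rfl⟩

/-- The setting of computations from `∃²`, a representation and a name of a point. -/
def pointSetting : Setting PointedQuasiRep :=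
  ⟨fun c => c.Φ, fun c => [fn c.α], 1, fun _ => rfl⟩

theorem cut_point {X : Type} [Primcodable X] :
    pointSetting.Cut fun (c : PointedQuasiRep) (_ : X) => (c.x : ℝ) :=
  .of_names (β := fun c _ => c.α) (fun c _ => c.names)
    (.applyRest (fun _ => rfl) Setting.Comp.id.snd)

open Setting

theorem computes_contSet : ∃ e : ℕ, ∀ f : Icc (0 : ℝ) 1 → ℝ, QuasiContinuous f →
    ∀ Φ : (ℕ → ℕ) → ℕ, Represents Φ f → ∀ (x : Icc (0 : ℝ) 1) (α : ℕ → ℕ), Names α x →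
      (x ∈ contSet f → Kleene e [fnl existsTwo, fnl Φ, fn α] 1) ∧
      (x ∉ contSet f → Kleene e [fnl existsTwo, fnl Φ, fn α] 0) := by
  classical
  have h : pointSetting.Dec fun c (_ : Unit) => c.x ∈ contSet c.f :=
    dec_mem_contSet (fun c => c.quasi) (fun c => c.rep) cut_point
  obtain ⟨e, he⟩ := (Comp.map Primrec.encode h).index₀
  refine ⟨e, fun f hf Φ hΦ x α hα => ⟨fun hx => ?_, fun hx => ?_⟩⟩
  · have := he ⟨⟨f, Φ, hf, hΦ⟩, x, α, hα⟩
    simp only [hx, decide_true, Encodable.encode_true] at this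
    exact this
  · have := he ⟨⟨f, Φ, hf, hΦ⟩, x, α, hα⟩
    simp only [hx, decide_false, Encodable.encode_false] at this
    exact this

theorem computes_contPoint : ∃ e : ℕ, ∀ f : Icc (0 : ℝ) 1 → ℝ, QuasiContinuous f →
    ∀ Φ : (ℕ → ℕ) → ℕ, Represents Φ f →
      ComputesReal e [fnl existsTwo, fnl Φ] (contPoint f) := by
  obtain ⟨e, he⟩ := Cut.computesReal₀ (S := repSetting)
    (cut_contPoint (fun c => c.quasi) (fun c => c.rep))
  exact ⟨e, fun f hf Φ hΦ => he ⟨f, Φ, hf, hΦ⟩⟩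

theorem computes_smallBall : ∃ e : ℕ, ∀ f : Icc (0 : ℝ) 1 → ℝ, QuasiContinuous f →
    ∀ Φ : (ℕ → ℕ) → ℕ, Represents Φ f → ∀ n i,
      Kleene e [fnl existsTwo, fnl Φ, num n, num i] (smallBall f n i) := by
  obtain ⟨e, he⟩ :=
    (comp_smallBall (S := repSetting) (fun c => c.quasi) (fun c => c.rep)).index₂
  exact ⟨e, fun f hf Φ hΦ n i => he ⟨f, Φ, hf, hΦ⟩ n i⟩

theorem computes_oscillation : ∃ e : ℕ, ∀ f : Icc (0 : ℝ) 1 → ℝ, QuasiContinuous f →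
    ∀ Φ : (ℕ → ℕ) → ℕ, Represents Φ f → ∀ (x : Icc (0 : ℝ) 1) (α : ℕ → ℕ), Names α x →
      ComputesExt e [fnl existsTwo, fnl Φ, fn α]
        (⨅ k : ℕ, oscOn f (Metric.ball x (1 / 2 ^ k))) := by
  obtain ⟨e, he⟩ := ECut.computesExt₀ (S := pointSetting)
    (v := fun c _ => ⨅ k : ℕ, oscOn c.f (Metric.ball c.x (1 / 2 ^ k)))
    (ecut_oscillation (fun c => c.quasi) (fun c => c.rep) cut_point)
    fun c _ => oscillation_ne_bot c.f c.x
  exact ⟨e, fun f hf Φ hΦ x α hα => he ⟨⟨f, Φ, hf, hΦ⟩, x, α, hα⟩⟩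

theorem computes_sup : ∃ e : ℕ, ∀ f : Icc (0 : ℝ) 1 → ℝ, QuasiContinuous f →
    ∀ Φ : (ℕ → ℕ) → ℕ, Represents Φ f → ∀ p q : ℕ,
      ComputesExt e [fnl existsTwo, fnl Φ, num p, num q] (ratSup f p q) := by
  obtain ⟨e, he⟩ := ECut.computesExt₂ (S := repSetting)
    (ecut_ratSup (fun c => c.quasi) (fun c => c.rep))
    fun c p => ((EReal.bot_lt_coe _).trans_le (le_max_left _ _)).ne'
  exact ⟨e, fun f hf Φ hΦ p q => he ⟨f, Φ, hf, hΦ⟩ p q⟩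

theorem computes_contModulus : ∃ e : ℕ, ∀ f : Icc (0 : ℝ) 1 → ℝ, QuasiContinuous f →
    ∀ Φ : (ℕ → ℕ) → ℕ, Represents Φ f → ∀ (x : Icc (0 : ℝ) 1) (α : ℕ → ℕ), Names α x → ∀ k,
      Kleene e [fnl existsTwo, fnl Φ, fn α, num k] (contModulus f x k) := by
  obtain ⟨e, he⟩ := (comp_contModulus (S := pointSetting) (fun c => c.quasi) (fun c => c.rep)
    cut_point).index₁
  exact ⟨e, fun f hf Φ hΦ x α hα k => he ⟨⟨f, Φ, hf, hΦ⟩, x, α, hα⟩ k⟩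

theorem computes_nearInterval : ∃ e : ℕ, ∀ f : Icc (0 : ℝ) 1 → ℝ, QuasiContinuous f →
    ∀ Φ : (ℕ → ℕ) → ℕ, Represents Φ f → ∀ (x : Icc (0 : ℝ) 1) (α : ℕ → ℕ), Names α x →
      ∀ k N, Kleene e [fnl existsTwo, fnl Φ, fn α, num k, num N] (nearInterval f x k N) := by
  obtain ⟨e, he⟩ := (comp_nearInterval (S := pointSetting) (fun c => c.quasi) (fun c => c.rep)
    cut_point).index₂
  exact ⟨e, fun f hf Φ hΦ x α hα k N => he ⟨⟨f, Φ, hf, hΦ⟩, x, α, hα⟩ k N⟩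

theorem computes_coverBound : ∃ e : ℕ, ∀ Ψ : Icc (0 : ℝ) 1 → ℝ, QuasiContinuous Ψ →
    ∀ Φ : (ℕ → ℕ) → ℕ, Represents Φ Ψ →
      Kleene e [fnl existsTwo, fnl Φ] (coverBound Ψ) := by
  obtain ⟨e, he⟩ := (comp_coverBound (S := repSetting) (X := Unit) (fun c => c.rep)).index₀
  exact ⟨e, fun Ψ hΨ Φ hΦ => he ⟨Ψ, Φ, hΨ, hΦ⟩⟩

theorem computes_unitPoint : ∃ e : ℕ, ∀ Ψ : Icc (0 : ℝ) 1 → ℝ, QuasiContinuous Ψ →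
    ∀ Φ : (ℕ → ℕ) → ℕ, Represents Φ Ψ → ∀ i : ℕ,
      ComputesReal e [fnl existsTwo, fnl Φ, num i] (unitPoint i) := by
  obtain ⟨e, he⟩ := Cut.computesReal₁ (S := repSetting) (Cut.unitPoint Comp.id)
  exact ⟨e, fun Ψ hΨ Φ hΦ i => he ⟨Ψ, Φ, hΨ, hΦ⟩ i⟩

theorem theorem2p3 :
    -- (a) the set of continuity points is decided, and one of its points is computed
    (∃ e : ℕ, ∀ f : Icc (0 : ℝ) 1 → ℝ, QuasiContinuous f →
      ∀ Φ : (ℕ → ℕ) → ℕ, Represents Φ f →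
      ∀ (x : Icc (0 : ℝ) 1) (α : ℕ → ℕ), Names α x →
        (x ∈ contSet f → Kleene e [fnl existsTwo, fnl Φ, fn α] 1) ∧
        (x ∉ contSet f → Kleene e [fnl existsTwo, fnl Φ, fn α] 0)) ∧
    (∃ e : ℕ, ∀ f : Icc (0 : ℝ) 1 → ℝ, QuasiContinuous f →
      ∃ x ∈ contSet f, ∀ Φ : (ℕ → ℕ) → ℕ, Represents Φ f →
        ComputesReal e [fnl existsTwo, fnl Φ] (x : ℝ)) ∧
    -- (b) the set of continuity points as an intersection of coded open sets
    (∃ e : ℕ, ∀ f : Icc (0 : ℝ) 1 → ℝ, QuasiContinuous f →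
      ∃ B : ℕ → ℕ → ℚ × ℚ, (∀ n i, 0 < (B n i).2) ∧
        contSet f = ⋂ n, ⋃ i,
          {x : Icc (0 : ℝ) 1 | (x : ℝ) ∈ Metric.ball ((B n i).1 : ℝ) ((B n i).2 : ℝ)} ∧
        ∀ Φ : (ℕ → ℕ) → ℕ, Represents Φ f →
          ∀ n i, ComputesRatPair e [fnl existsTwo, fnl Φ, num n, num i] (B n i)) ∧
    -- (c) the oscillation function
    (∃ e : ℕ, ∀ f : Icc (0 : ℝ) 1 → ℝ, QuasiContinuous f →
      ∃ osc : Icc (0 : ℝ) 1 → EReal, (∀ x, IsOscAt f x (osc x)) ∧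
        ∀ Φ : (ℕ → ℕ) → ℕ, Represents Φ f →
          ∀ (x : Icc (0 : ℝ) 1) (α : ℕ → ℕ), Names α x →
            ComputesExt e [fnl existsTwo, fnl Φ, fn α] (osc x)) ∧
    -- (d) suprema on rational intervals
    (∃ e : ℕ, ∀ f : Icc (0 : ℝ) 1 → ℝ, QuasiContinuous f →
      ∀ Φ : (ℕ → ℕ) → ℕ, Represents Φ f →
        ∀ p q : ℕ, 0 ≤ ratOf p → ratOf p ≤ ratOf q → ratOf q ≤ 1 →
          ComputesExt e [fnl existsTwo, fnl Φ, num p, num q]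
            (⨆ (x : Icc (0 : ℝ) 1) (_ : (ratOf p : ℝ) ≤ x ∧ (x : ℝ) ≤ ratOf q), (f x : EReal))) ∧
    -- (e) a modulus of continuity
    (∃ e : ℕ, ∀ f : Icc (0 : ℝ) 1 → ℝ, QuasiContinuous f →
      ∃ F : Icc (0 : ℝ) 1 → ℕ → ℕ, IsModulusCont f F ∧
        ∀ Φ : (ℕ → ℕ) → ℕ, Represents Φ f →
          ∀ (x : Icc (0 : ℝ) 1) (α : ℕ → ℕ), Names α x →
            ∀ k, Kleene e [fnl existsTwo, fnl Φ, fn α, num k] (F x k)) ∧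
    -- (f) a modulus of quasi-continuity
    (∃ e : ℕ, ∀ f : Icc (0 : ℝ) 1 → ℝ, QuasiContinuous f →
      ∃ F : Icc (0 : ℝ) 1 → ℕ → ℕ → ℚ × ℚ, IsModulusQuasiCont f F ∧
        ∀ Φ : (ℕ → ℕ) → ℕ, Represents Φ f →
          ∀ (x : Icc (0 : ℝ) 1) (α : ℕ → ℕ), Names α x →
            ∀ k N, ComputesRatPair e [fnl existsTwo, fnl Φ, fn α, num k, num N] (F x k N)) ∧
    -- (g) finite sub-coverings; `Ψ` is the radius function, `m + 1` the number of points
    (∃ e₁ e₂ : ℕ, ∀ Ψ : Icc (0 : ℝ) 1 → ℝ, QuasiContinuous Ψ → (∀ x, 0 < Ψ x) →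
      ∃ (m : ℕ) (x : Fin (m + 1) → Icc (0 : ℝ) 1),
        (∀ y : Icc (0 : ℝ) 1, ∃ i, y ∈ Metric.ball (x i) (Ψ (x i))) ∧
        ∀ Φ : (ℕ → ℕ) → ℕ, Represents Φ Ψ →
          Kleene e₁ [fnl existsTwo, fnl Φ] m ∧
          ∀ i : Fin (m + 1), ComputesReal e₂ [fnl existsTwo, fnl Φ, num i] (x i : ℝ)) ∧
    -- (h) a zero of a function with integral zero
    (∃ e : ℕ, ∀ f : Icc (0 : ℝ) 1 → ℝ, QuasiContinuous f → (∀ x, 0 ≤ f x ∧ f x ≤ 1) →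
      HasRiemannIntegral f 0 1 0 →
      ∃ x : Icc (0 : ℝ) 1, f x = 0 ∧ ∀ Φ : (ℕ → ℕ) → ℕ, Represents Φ f →
        ComputesReal e [fnl existsTwo, fnl Φ] (x : ℝ)) ∧
    -- (i) a point where the fundamental theorem of calculus holds
    (∃ e : ℕ, ∀ f : Icc (0 : ℝ) 1 → ℝ, QuasiContinuous f →
      ∀ F : ℝ → ℝ, (∀ x : Icc (0 : ℝ) 1, HasRiemannIntegral f 0 x (F x)) →
      ∃ x₀ : Icc (0 : ℝ) 1, 0 < (x₀ : ℝ) ∧ (x₀ : ℝ) < 1 ∧ HasDerivAt F (f x₀) (x₀ : ℝ) ∧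
        ∀ Φ : (ℕ → ℕ) → ℕ, Represents Φ f →
          ComputesReal e [fnl existsTwo, fnl Φ] (x₀ : ℝ)) := by
  refine ⟨computes_contSet, ?_, ?_, ?_, ?_, ?_, ?_, ?_, ?_, ?_⟩
  · obtain ⟨e, he⟩ := computes_contPoint
    exact ⟨e, fun f hf => ⟨_, hf.contPoint_mem_contSet, he f hf⟩⟩
  · obtain ⟨e, he⟩ := computes_smallBall
    exact ⟨e, fun f hf => ⟨fun n i => ratPairOf (smallBall f n i), smallBall_pos f,
      contSet_eq_iInter_smallBall f, fun Φ hΦ n i => ⟨_, rfl, he f hf Φ hΦ n i⟩⟩⟩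
  · obtain ⟨e, he⟩ := computes_oscillation
    exact ⟨e, fun f hf => ⟨_, isOscAt_iInf f, he f hf⟩⟩
  · obtain ⟨e, he⟩ := computes_sup
    refine ⟨e, fun f hf Φ hΦ p q h₀ hpq h₁ => ?_⟩
    rw [← ratSup_eq f h₀ hpq h₁]
    exact he f hf Φ hΦ p q
  · obtain ⟨e, he⟩ := computes_contModulus
    exact ⟨e, fun f hf => ⟨_, isModulusCont_contModulus f, he f hf⟩⟩
  · obtain ⟨e, he⟩ := computes_nearInterval
    exact ⟨e, fun f hf => ⟨_, hf.isModulusQuasiCont, fun Φ hΦ x α hα k N =>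
      ⟨_, rfl, he f hf Φ hΦ x α hα k N⟩⟩⟩
  · obtain ⟨e₁, he₁⟩ := computes_coverBound
    obtain ⟨e₂, he₂⟩ := computes_unitPoint
    refine ⟨e₁, e₂, fun Ψ hΨ hpos => ⟨coverBound Ψ, fun i => unitPoint i, fun y => ?_,
      fun Φ hΦ => ⟨he₁ Ψ hΨ Φ hΦ, fun i => he₂ Ψ hΨ Φ hΦ i⟩⟩⟩
    obtain ⟨i, hi, hy⟩ := hΨ.exists_mem_ball_of_le_coverBound hpos y
    exact ⟨⟨i, Nat.lt_succ_of_le hi⟩, hy⟩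
  · obtain ⟨e, he⟩ := computes_contPoint
    exact ⟨e, fun f hf h01 hint => ⟨⟨contPoint f, hf.contPoint_mem⟩,
      hint.eq_zero_of_continuousAt (fun x => (h01 x).1) hf.contPoint_mem_contSet, he f hf⟩⟩
  · obtain ⟨e, he⟩ := computes_contPoint
    exact ⟨e, fun f hf F hF => ⟨⟨contPoint f, hf.contPoint_mem⟩, hf.contPoint_pos,
      hf.contPoint_lt_one, hasDerivAt_of_hasRiemannIntegral hF hf.contPoint_pos
        hf.contPoint_lt_one hf.contPoint_mem_contSet, he f hf⟩⟩
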